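/- Let $p_0=1$, $q_0=0$ and, for $k\ge 1$, $p_k,q_k>0$ with $p_k+q_k=1$; put $\rho_k=q_k/p_k$ for $k\ge1$. Let $X=(X_k)_{k\ge0}$ be the Markov chain on $\{0,1,2,\dots\}$ with $X_0=0$ that jumps from $n$ to $n+1$ with probability $p_n$ and from $n$ to $n-1$ with probability $q_n$. For $n> m\ge 0$ put $D(m,n)=\sum_{j=0}^{n-m-1}\rho_{m+1}\cdots\rho_{m+j}$ (the $j=0$ term is $1$) and $D(m)=\lim_{n\to\infty}D(m,n)$. Let $\xi(x)=\#\{k:X_k=x\}$ be the local time and $\xi(x,\uparrow)=\#\{k:X_k=x,\,X_{k+1}=x+1\}$ the upcrossing time of $x$. For integers $a\ge b\ge1$ let $C(a,b)=\{x:\xi(x)=a,\ \xi(x,\uparrow)=b\}$; for $a\ge 1$ let $C(*,a)=\{x:a\le \xi(x)<\infty,\ \xi(x,\uparrow)=a\}$; let $C_w$ be the set of weak cutpoints, that is, of the $x$ such that for some $k$ we have $X_k=x$, $X_i\le x$ for all $i<k$ and $X_i\ge x$ for all $i>k$. Suppose that the walk is transient in the sense that $\sum_{k\ge1}\rho_1\cdots\rho_k<\infty$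 (equivalently, $D(m)<\infty$ for all $m$), and that $\rho_k\to1$ as $k\to\infty$. Let $C$ be $C_w$, $C(a,b)$ or $C(*,a)$, and let $\lambda_C=2$, $\lambda_C=2^{-a}\binom{a-1}{b-1}$, $\lambda_C=1$ respectively. Then 1. $\lim_{x\to\infty}\mathbb P(x\in C)\,D(x)=\lambda_C$. 2. There is a constant $c\in(0,\infty)$ such that for all $y>x\ge0$, $\displaystyle \mathbb P(y\in C\mid x\in C)\le \frac{c\,D(x)}{D(x,y)D(y)}$. (The conditioning event is null only if $x=0$ and $C=C(a,b)$ with $a\neq b$; the conditional probability is then read as $0$.) 3. There is a constant $c\in(0,\infty)$ such that $\displaystyle \mathbb P(x\in C\mid y\in C)\ge \frac{c}{D(x,y)}$ for all $y>x\ge0$, where for $C=C(a,b)$ it is moreover required that $x\ge1$ or $a=b$, and that $y\ge x+2$ or $a=2b-1$. (In the excluded cases the left-hand side is $0$.) 4. For every $k\ge1$ there is a constant $c\in(0,\infty)$ such that for all $0<j_1<\dots<j_k$, $$\mathbb P(j_1\in C,\dots,j_k\in C)\le \frac{c}{\left(\prod_{i=1}^{k-1}D(j_i,j_{i+1})\right)D(j_k)}.$$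 5. For every $\varepsilon$ with $0<\varepsilon<\lambda_C$ there is $N>0$ such that for all $x>N$ and $y>x+N$, $$1-\varepsilon\le \frac{D(x,y)}{D(x)}\,\frac{\mathbb P(x\in C,\,y\in C)}{\mathbb P(x\in C)\,\mathbb P(y\in C)}\le 1+\varepsilon,$$ $$(\lambda_C-\varepsilon)\frac{D(x)}{D(x,y)D(y)}\le \mathbb P(y\in C\mid x\in C)\le(\lambda_C+\varepsilon)\frac{D(x)}{D(x,y)D(y)},$$ and such that for all $k\ge1$ and all $0=j_0<j_1<\dots<j_k$ with $j_i-j_{i-1}>N$ for $i=1,\dots,k$, $$\frac{(\lambda_C-\varepsilon)^k}{D(j_k)\prod_{i=1}^{k-1}D(j_i,j_{i+1})}\le\mathbb P(j_1\in C,\dots,j_k\in C)\le\frac{(\lambda_C+\varepsilon)^k}{D(j_k)\prod_{i=1}^{k-1}D(j_i,j_{i+1})}.$$ -/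

import Mathlib

open Filter Topology MeasureTheory

namespace CutWalk

noncomputable section

/-- One-step transition probabilities of the nearest-neighbour walk on `ℕ`: from `n` the walk goes
to `n + 1` with probability `p n` and to `n - 1` with probability `q n = 1 - p n`. -/
def trans (p : ℕ → ℝ) (n m : ℕ) : ℝ :=
  if m = n + 1 then p n else if n = m + 1 then 1 - p n else 0

/-- `X` is a Markov chain on `ℕ`, started from `0`, with transition probabilities `trans p`.
The Markov property is written in product form, so that conditioning on null events is harmless. -/
structure IsWalk {Ω : Type*} [MeasurableSpace Ω] (P : Measure Ω) (p : ℕ → ℝ)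
    (X : ℕ → Ω → ℕ) : Prop where
  measurable : ∀ k, Measurable (X k)
  start : ∀ᵐ ω ∂P, X 0 ω = 0
  markov : ∀ (n : ℕ) (x : ℕ → ℕ),
    P {ω | ∀ i ≤ n + 1, X i ω = x i} =
      P {ω | ∀ i ≤ n, X i ω = x i} * ENNReal.ofReal (trans p (x n) (x (n + 1)))

/-- `ρ k = q k / p k`. -/
def rho (p : ℕ → ℝ) (k : ℕ) : ℝ := (1 - p k) / p k

/-- `D(m, n) = 1 + ρ (m+1) + ρ (m+1) ρ (m+2) + ⋯ + ρ (m+1) ⋯ ρ (n-1)` for `n > m`, and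
`D(m, m) = 0`. -/
def Dfin (p : ℕ → ℝ) (m n : ℕ) : ℝ :=
  ∑ j ∈ Finset.range (n - m), ∏ i ∈ Finset.Icc (m + 1) (m + j), rho p i

/-- `D(m) = lim D(m, n)` as `n → ∞`. -/
def D (p : ℕ → ℝ) (m : ℕ) : ℝ := limUnder atTop (fun n => Dfin p m n)

/-- Local time of the path `w` at `x`. -/
def localTime (w : ℕ → ℕ) (x : ℕ) : ℕ∞ := Set.encard {k | w k = x}

/-- Number of upcrossings of the path `w` from `x` to `x + 1`. -/
def upTime (w : ℕ → ℕ) (x : ℕ) : ℕ∞ := Set.encard {k | w k = x ∧ w (k + 1) = x + 1}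

/-- `C(A, B)`: the sites whose local time lies in `A` and whose upcrossing time lies in `B`
(both are then finite). -/
def cutSet (A B : Set ℕ) (w : ℕ → ℕ) : Set ℕ :=
  {x | (∃ a ∈ A, localTime w x = a) ∧ ∃ b ∈ B, upTime w x = b}

/-- `C_w`: the weak cutpoints of the path `w`. -/
def weakCutSet (w : ℕ → ℕ) : Set ℕ :=
  {x | ∃ k, w k = x ∧ (∀ i < k, w i ≤ x) ∧ ∀ i > k, x ≤ w i}

/-- The three families of random sets: `weak` is `C_w`, `both a b` is `C(a, b)` and
`up a` is `C(*, a)`. -/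
inductive CutClass where
  | weak : CutClass
  | both (a b : ℕ) : CutClass
  | up (a : ℕ) : CutClass

namespace CutClass

/-- Range of the parameters: `a ≥ b ≥ 1` for `C(a, b)` and `a ≥ 1` for `C(*, a)`. -/
def Valid : CutClass → Prop
  | weak => True
  | both a b => 1 ≤ b ∧ b ≤ a
  | up a => 1 ≤ a

/-- The set of sites of the path `w` that belong to the class. -/
def sites : CutClass → (ℕ → ℕ) → Set ℕ
  | weak, w => weakCutSet w
  | both a b, w => cutSet {a} {b} w
  | up a, w => cutSet {n | a ≤ n} {a} w

/-- The constant `λ_C`. -/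
def lam : CutClass → ℝ
  | weak => 2
  | both a b => (Nat.choose (a - 1) (b - 1) : ℝ) / 2 ^ a
  | up _ => 1

/-- The pairs `x < y` for which `x` and `y` can both belong to the class. It excludes, for `C(a, b)`
only, the site `x = 0` when `a ≠ b` (all jumps from `0` are upward, so `0` is never in `C(a, b)`) and
neighbours `y = x + 1` when `a ≠ 2 b - 1` (transient paths make exactly one more jump from `x` to
`x + 1` than back, so `x, x + 1 ∈ C(a, b)` forces `a - b = b - 1`). -/
def Compatible : CutClass → ℕ → ℕ → Prop
  | weak, _, _ => True
  | both a b, x, y => (1 ≤ x ∨ a = b) ∧ (x + 2 ≤ y ∨ a + 1 = 2 * b)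
  | up _, _, _ => True

/-- The event `{x ∈ C}` for the process `X`. -/
def event {Ω : Type*} (C : CutClass) (X : ℕ → Ω → ℕ) (x : ℕ) : Set Ω :=
  {ω | x ∈ C.sites (fun k => X k ω)}

end CutClass

end

end CutWalk

/-! The joint law of the events x ∈ C is computed exactly. For j_1 < ... < j_k it is the product of
`pairWeight` over consecutive pairs times `lastWeight` at j_k (`CutClass.real_forall_event`). So P(x
∈ C | y ∈ C) equals `pairWeight` for x < y, and all five claims reduce to estimates: `lastWeight`
times D(y) is bounded and tends to λ, and `pairWeight` times D(x, y) is bounded, bounded below on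
compatible pairs, and tends to λ as x and y - x go to infinity.

The product form comes from edge crossings. An escaping path makes one more upcrossing of x than
descents from x + 1 to x. Hence C(*, a) prescribes a upcrossings of x. For x ≥ 1, C(a, b) prescribes
a - b + 1 upcrossings of x - 1 and b of x, because visits to x that are followed by a down step are
descents through the lower edge. A weak cutpoint is a site below which the walk never goes after
having been above it. Once the behaviour at an upper site y is prescribed, what happens above y no
longer matters for a lower site, so the sites form a Markov chain read from the top down. Its
transition probabilities are gambler's ruin probabilities, D(x, ·) being harmonic above x.

No strong Markov property is needed. The conditional probability of an event given the history is
written down as an explicit bounded function of the history, harmonic and convergent to the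
indicator (`Solves`). Its expectation is constant in time, so the probability is its value at the
initial history [0] (`IsWalk.real_eq_of_harmonic`). For several sites this function is a product in
which only one factor varies at each step: while the walk is low for y the factor of y is frozen,
otherwise the linking factor of x is (`Links`, `Solves.mul`).

For the asymptotics, ρ → 1 makes D(x, y) large compared with its first and last terms, uniformly for
x and y - x large (`exists_le_Dfin`, `exists_mul_rhoProd_le`). The ruin probabilities `betaUp` and
`alphaDown` then tend to 0, while for the adjacent levels x - 1 and x both tend to 1/2. The latter
limit produces the binomial coefficient in λ (`weight_half`). -/

open scoped ENNReal

namespace CutWalk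

noncomputable section

/-! ### Histories and harmonic functions of the history -/

/-- The history of the path `w` up to time `n`, the most recent position first. -/
def hist (w : ℕ → ℕ) : ℕ → List ℕ
  | 0 => [w 0]
  | n + 1 => w (n + 1) :: hist w n

/-- Histories of nearest-neighbour paths started from `0`. -/
def IsPath : List ℕ → Prop
  | [] => False
  | [a] => a = 0
  | a :: b :: l => (a = b + 1 ∨ b = a + 1) ∧ IsPath (b :: l)

/-- Expected value of `g` after one more step of the walk. -/
def step (p : ℕ → ℝ) (g : List ℕ → ℝ≥0∞) (l : List ℕ) : ℝ≥0∞ :=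
  ENNReal.ofReal (p l.headI) * g ((l.headI + 1) :: l) +
    ENNReal.ofReal (1 - p l.headI) * g ((l.headI - 1) :: l)

theorem hist_eq_iff (w w' : ℕ → ℕ) (n : ℕ) :
    hist w n = hist w' n ↔ ∀ i ≤ n, w i = w' i := by
  induction n with
  | zero => simp [hist]
  | succ n ih =>
    simp only [hist, List.cons.injEq, ih]
    constructor
    · rintro ⟨h1, h2⟩ i hi
      rcases Nat.lt_or_ge n i with h | h
      · obtain rfl : i = n + 1 := by omega
        exact h1
      · exact h2 i h
    · intro h
      exact ⟨h _ le_rfl, fun i hi => h i (by omega)⟩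

@[simp] theorem headI_hist (w : ℕ → ℕ) (n : ℕ) : (hist w n).headI = w n := by
  cases n <;> rfl

theorem hist_eq_cons (w : ℕ → ℕ) (n : ℕ) : ∃ l, hist w n = w n :: l := by
  cases n with
  | zero => exact ⟨[], rfl⟩
  | succ n => exact ⟨hist w n, rfl⟩

section Histories

variable {Ω : Type*} [MeasurableSpace Ω] {P : Measure Ω} {p : ℕ → ℝ} {X : ℕ → Ω → ℕ}

theorem measurableSet_hist_eq (hX : ∀ k, Measurable (X k)) (n : ℕ) (l : List ℕ) :
    MeasurableSet {ω | hist (fun k => X k ω) n = l} := by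
  induction n generalizing l with
  | zero =>
    have : {ω | hist (fun k => X k ω) 0 = l} = X 0 ⁻¹' {a | [a] = l} := rfl
    rw [this]
    exact hX 0 (MeasurableSet.of_discrete)
  | succ n ih =>
    cases l with
    | nil => simp [hist]
    | cons a l =>
      have : {ω | hist (fun k => X k ω) (n + 1) = a :: l} =
          X (n + 1) ⁻¹' {a} ∩ {ω | hist (fun k => X k ω) n = l} := by
        ext ω; simp [hist]
      rw [this]
      exact (hX _ (MeasurableSet.singleton a)).inter (ih l)

theorem measurable_comp_hist {β : Type*} [MeasurableSpace β] (hX : ∀ k, Measurable (X k)) (n : ℕ)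
    (g : List ℕ → β) : Measurable fun ω => g (hist (fun k => X k ω) n) := by
  intro s _
  have : (fun ω => g (hist (fun k => X k ω) n)) ⁻¹' s =
      ⋃ l ∈ g ⁻¹' s, {ω | hist (fun k => X k ω) n = l} := by
    ext ω; simp
  rw [this]
  exact MeasurableSet.biUnion (Set.to_countable _) fun l _ => measurableSet_hist_eq hX n l

/-- The Markov property in `IsWalk` speaks of prescribed sequences. A history that is realized by
some ω₀ is such a prescription, and one that is not realized gives 0 on both sides. -/
theorem IsWalk.measure_hist_cons (hX : IsWalk P p X) (n : ℕ) (z : ℕ) (l : List ℕ) :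
    P (X (n + 1) ⁻¹' {z} ∩ {ω | hist (fun k => X k ω) n = l}) =
      P {ω | hist (fun k => X k ω) n = l} * ENNReal.ofReal (trans p l.headI z) := by
  rcases Set.eq_empty_or_nonempty {ω | hist (fun k => X k ω) n = l} with h | ⟨ω₀, h₀⟩
  · simp [h]
  · have h₀' : hist (fun k => X k ω₀) n = l := h₀
    have key := hX.markov n (fun i => if i = n + 1 then z else X i ω₀)
    have h1 : {ω | hist (fun k => X k ω) n = l} =
        {ω | ∀ i ≤ n, X i ω = if i = n + 1 then z else X i ω₀} := by
      ext ω
      simp only [Set.mem_ofPred_eq, ← h₀', hist_eq_iff]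
      refine forall₂_congr fun i hi => ?_
      rw [if_neg (by omega)]
    have h2 : X (n + 1) ⁻¹' {z} ∩ {ω | hist (fun k => X k ω) n = l} =
        {ω | ∀ i ≤ n + 1, X i ω = if i = n + 1 then z else X i ω₀} := by
      rw [h1]
      ext ω
      simp only [Set.mem_inter_iff, Set.mem_preimage, Set.mem_singleton_iff, Set.mem_ofPred_eq]
      constructor
      · rintro ⟨h3, h4⟩ i hi
        rcases Nat.lt_or_ge n i with h | h
        · obtain rfl : i = n + 1 := by omega
          simpa using h3
        · exact h4 i h
      · intro h
        exact ⟨by simpa using h _ le_rfl, fun i hi => h i (by omega)⟩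
    rw [h2, h1, key]
    congr 3
    · simp [← h₀']
    · simp

theorem IsWalk.setLIntegral_hist (hX : IsWalk P p X) (hp0 : p 0 = 1) (n : ℕ)
    (g : List ℕ → ℝ≥0∞) (l : List ℕ) :
    ∫⁻ ω in {ω | hist (fun k => X k ω) n = l}, g (hist (fun k => X k ω) (n + 1)) ∂P =
      ∫⁻ ω in {ω | hist (fun k => X k ω) n = l}, step p g (hist (fun k => X k ω) n) ∂P := by
  have hm := measurableSet_hist_eq hX.measurable n l
  have e1 : ∫⁻ ω in {ω | hist (fun k => X k ω) n = l}, g (hist (fun k => X k ω) (n + 1)) ∂P =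
      ∫⁻ ω in {ω | hist (fun k => X k ω) n = l}, g (X (n + 1) ω :: l) ∂P := by
    refine setLIntegral_congr_fun hm fun ω hω => ?_
    have hω' : hist (fun k => X k ω) n = l := hω
    simp [hist, hω']
  have e2 : ∫⁻ ω in {ω | hist (fun k => X k ω) n = l}, step p g (hist (fun k => X k ω) n) ∂P =
      ∫⁻ ω in {ω | hist (fun k => X k ω) n = l}, step p g l ∂P := by
    refine setLIntegral_congr_fun hm fun ω hω => ?_
    have hω' : hist (fun k => X k ω) n = l := hω
    simp [hω']
  rw [e1, e2, setLIntegral_const,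
    ← lintegral_map (f := fun z => g (z :: l)) (Measurable.of_discrete) (hX.measurable (n + 1)),
    lintegral_countable']
  have e3 : ∀ z, ((P.restrict {ω | hist (fun k => X k ω) n = l}).map (X (n + 1))) {z} =
      P {ω | hist (fun k => X k ω) n = l} * ENNReal.ofReal (trans p l.headI z) := by
    intro z
    rw [Measure.map_apply (hX.measurable _) (MeasurableSet.singleton z),
      Measure.restrict_apply (hX.measurable _ (MeasurableSet.singleton z)),
      hX.measure_hist_cons]
  simp only [e3]
  -- At 0 the truncated neighbour `0 - 1 = 0` is spurious, but its weight `1 - p 0` vanishes.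
  rw [tsum_eq_sum (s := {l.headI + 1, l.headI - 1})]
  · rw [Finset.sum_pair (by omega)]
    have t1 : trans p l.headI (l.headI + 1) = p l.headI := by simp [trans]
    have t2 : trans p l.headI (l.headI - 1) = 1 - p l.headI := by
      rcases Nat.eq_zero_or_pos l.headI with h | h
      · simp [trans, h, hp0]
      · rw [trans, if_neg (by omega), if_pos (by omega)]
    rw [t1, t2, step]
    ring
  · intro z hz
    simp only [Finset.mem_insert, Finset.mem_singleton, not_or] at hz
    have : trans p l.headI z = 0 := by
      rw [trans, if_neg hz.1, if_neg (by omega)]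
    simp [this]

/-- There are countably many histories, so conditioning on the past is a sum over their values.
Working in `ℝ≥0∞` removes integrability questions. -/
theorem IsWalk.lintegral_hist_succ (hX : IsWalk P p X) (hp0 : p 0 = 1) (n : ℕ)
    (g : List ℕ → ℝ≥0∞) :
    ∫⁻ ω, g (hist (fun k => X k ω) (n + 1)) ∂P =
      ∫⁻ ω, step p g (hist (fun k => X k ω) n) ∂P := by
  have hU : (⋃ l : List ℕ, {ω | hist (fun k => X k ω) n = l}) = Set.univ := by
    ext ω; simp
  have hsplit : ∀ f : Ω → ℝ≥0∞, ∫⁻ ω, f ω ∂P =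
      ∑' l : List ℕ, ∫⁻ ω in {ω | hist (fun k => X k ω) n = l}, f ω ∂P := by
    intro f
    rw [← setLIntegral_univ, ← hU,
      lintegral_iUnion (fun l => measurableSet_hist_eq hX.measurable n l)]
    intro l l' hll
    exact Set.disjoint_left.2 fun ω (h : _ = l) (h' : _ = l') => hll (h.symm.trans h')
  rw [hsplit, hsplit]
  exact tsum_congr fun l => hX.setLIntegral_hist hp0 n g l

theorem IsWalk.ae_isPath (hX : IsWalk P p X) (hp0 : p 0 = 1) :
    ∀ᵐ ω ∂P, ∀ n, IsPath (hist (fun k => X k ω) n) := by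
  rw [ae_all_iff]
  intro n
  induction n with
  | zero =>
    filter_upwards [hX.start] with ω h
    exact h
  | succ n ih =>
    classical
    -- `step p g` vanishes on legal histories, so illegal ones have measure 0 at the next time too.
    set g : List ℕ → ℝ≥0∞ := fun l => if IsPath l then 0 else 1 with hg
    have h0 : ∫⁻ ω, g (hist (fun k => X k ω) (n + 1)) ∂P = 0 := by
      rw [hX.lintegral_hist_succ hp0, lintegral_eq_zero_iff
        (measurable_comp_hist hX.measurable n (step p g))]
      filter_upwards [ih] with ω h
      obtain ⟨l, hl⟩ := hist_eq_cons (fun k => X k ω) n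
      rw [hl] at h ⊢
      generalize X n ω = z at *
      have h1 : g ((z + 1) :: z :: l) = 0 := if_pos ⟨Or.inl rfl, h⟩
      rcases Nat.eq_zero_or_pos z with hz | hz
      · subst hz
        simpa [step, hp0] using h1
      · have h2 : g ((z - 1) :: z :: l) = 0 := if_pos ⟨Or.inr (by omega), h⟩
        simp [step, h1, h2]
    rw [lintegral_eq_zero_iff (measurable_comp_hist hX.measurable (n + 1) g)] at h0
    filter_upwards [h0] with ω h
    by_contra hc
    simp [hg, hc] at h

/-- `Φ` is harmonic along nearest-neighbour histories. -/
def Harmonic (p : ℕ → ℝ) (Φ : List ℕ → ℝ) : Prop :=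
  ∀ z l, IsPath (z :: l) →
    Φ (z :: l) = p z * Φ ((z + 1) :: z :: l) + (1 - p z) * Φ ((z - 1) :: z :: l)

theorem IsWalk.lintegral_harmonic [IsProbabilityMeasure P] (hX : IsWalk P p X) (hp0 : p 0 = 1)
    (hp : ∀ k, 0 ≤ p k ∧ p k ≤ 1) {Φ : List ℕ → ℝ} (hΦ : Harmonic p Φ) (h0 : ∀ l, 0 ≤ Φ l)
    (n : ℕ) : ∫⁻ ω, ENNReal.ofReal (Φ (hist (fun k => X k ω) n)) ∂P =
      ENNReal.ofReal (Φ [0]) := by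
  induction n with
  | zero =>
    have : ∫⁻ ω, ENNReal.ofReal (Φ (hist (fun k => X k ω) 0)) ∂P =
        ∫⁻ ω, ENNReal.ofReal (Φ [0]) ∂P := by
      refine lintegral_congr_ae ?_
      filter_upwards [hX.start] with ω h
      simp [hist, h]
    simpa using this
  | succ n ih =>
    rw [hX.lintegral_hist_succ hp0 n (fun l => ENNReal.ofReal (Φ l)), ← ih]
    refine lintegral_congr_ae ?_
    filter_upwards [hX.ae_isPath hp0] with ω h
    have hn := h n
    obtain ⟨l, hl⟩ := hist_eq_cons (fun k => X k ω) n
    rw [hl] at hn ⊢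
    generalize X n ω = z at *
    rw [hΦ z l hn, ENNReal.ofReal_add, ENNReal.ofReal_mul (hp z).1,
      ENNReal.ofReal_mul (by linarith [hp z])]
    · rfl
    · exact mul_nonneg (hp z).1 (h0 _)
    · exact mul_nonneg (by linarith [hp z]) (h0 _)

/-- A bounded harmonic function of the history that converges to the indicator of an event
computes the probability of this event. -/
theorem IsWalk.real_eq_of_harmonic [IsProbabilityMeasure P] (hX : IsWalk P p X) (hp0 : p 0 = 1)
    (hp : ∀ k, 0 ≤ p k ∧ p k ≤ 1) {Φ : List ℕ → ℝ} (hΦ : Harmonic p Φ) (h0 : ∀ l, 0 ≤ Φ l)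
    (h1 : ∀ l, Φ l ≤ 1) {E : Set Ω}
    (hlim : ∀ᵐ ω ∂P, Tendsto (fun n => Φ (hist (fun k => X k ω) n)) atTop
      (𝓝 (E.indicator (fun _ => 1) ω))) :
    NullMeasurableSet E P ∧ P.real E = Φ [0] := by
  have hmeas : ∀ n, Measurable fun ω => Φ (hist (fun k => X k ω) n) := fun n =>
    measurable_comp_hist hX.measurable n Φ
  -- Measurability of the event is a by-product: its indicator is an a.e. limit of measurable
  -- functions.
  have hE : NullMeasurableSet E P := by
    rw [← aemeasurable_indicator_const_iff (1 : ℝ)]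
    exact aemeasurable_of_tendsto_metrizable_ae atTop (fun n => (hmeas n).aemeasurable) hlim
  refine ⟨hE, ?_⟩
  have hint : ∀ n, ∫ ω, Φ (hist (fun k => X k ω) n) ∂P = Φ [0] := by
    intro n
    rw [integral_eq_lintegral_of_nonneg_ae (Eventually.of_forall fun ω => h0 _)
      (hmeas n).aestronglyMeasurable, hX.lintegral_harmonic hp0 hp hΦ h0,
      ENNReal.toReal_ofReal (h0 _)]
  have hl : Tendsto (fun n => ∫ ω, Φ (hist (fun k => X k ω) n) ∂P) atTop
      (𝓝 (∫ ω, E.indicator (fun _ => (1 : ℝ)) ω ∂P)) := by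
    refine tendsto_integral_of_dominated_convergence (fun _ => 1)
      (fun n => (hmeas n).aestronglyMeasurable) (integrable_const 1) ?_ hlim
    intro n
    refine Eventually.of_forall fun ω => ?_
    rw [Real.norm_eq_abs, abs_of_nonneg (h0 _)]
    exact h1 _
  simp only [hint] at hl
  have := tendsto_nhds_unique hl tendsto_const_nhds
  rw [integral_indicator₀ hE, setIntegral_const] at this
  simpa using this

end Histories

/-! ### The scale function `Dfin` and escape to infinity -/

/-- Nondegenerate reflecting transition probabilities for which the walk is transient. -/
structure IsTransient (p : ℕ → ℝ) : Prop where
  zero : p 0 = 1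
  mem : ∀ k, 1 ≤ k → 0 < p k ∧ p k < 1
  summable : Summable fun k : ℕ => ∏ i ∈ Finset.Icc 1 k, rho p i

/-- The product `ρ (x+1) ⋯ ρ y`. -/
def rhoProd (p : ℕ → ℝ) (x y : ℕ) : ℝ := ∏ i ∈ Finset.Icc (x + 1) y, rho p i

variable {p : ℕ → ℝ}

@[simp] theorem rhoProd_self (x : ℕ) : rhoProd p x x = 1 := by simp [rhoProd]

theorem rhoProd_succ {x y : ℕ} (h : x ≤ y) :
    rhoProd p x (y + 1) = rhoProd p x y * rho p (y + 1) := by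
  rw [rhoProd, Finset.prod_Icc_succ_top (by omega), rhoProd]

theorem rhoProd_mul {x y z : ℕ} (h : x ≤ y) (h' : y ≤ z) :
    rhoProd p x y * rhoProd p y z = rhoProd p x z := by
  induction z, h' using Nat.le_induction with
  | base => simp
  | succ z hz ih => rw [rhoProd_succ hz, rhoProd_succ (h.trans hz), ← ih, mul_assoc]

@[simp] theorem Dfin_self (x : ℕ) : Dfin p x x = 0 := by simp [Dfin]

theorem Dfin_succ {x y : ℕ} (h : x ≤ y) : Dfin p x (y + 1) = Dfin p x y + rhoProd p x y := by
  rw [Dfin, Nat.sub_add_comm h, Finset.sum_range_succ, Dfin, rhoProd]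
  congr 4
  omega

@[simp] theorem Dfin_self_succ (x : ℕ) : Dfin p x (x + 1) = 1 := by
  simp [Dfin_succ le_rfl]

theorem Dfin_eq_one_add {x y : ℕ} (h : x + 1 ≤ y) :
    Dfin p x y = 1 + rho p (x + 1) * Dfin p (x + 1) y := by
  induction y, h using Nat.le_induction with
  | base => simp
  | succ y hy ih =>
    rw [Dfin_succ (by omega), ih, Dfin_succ hy, ← rhoProd_mul (Nat.le_succ x) hy,
      rhoProd_succ le_rfl]
    simp
    ring

namespace IsTransient

theorem pos (hp : IsTransient p) (k : ℕ) : 0 < p k := by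
  rcases Nat.eq_zero_or_pos k with rfl | h
  · rw [hp.zero]; exact one_pos
  · exact (hp.mem k h).1

theorem le_one (hp : IsTransient p) (k : ℕ) : p k ≤ 1 := by
  rcases Nat.eq_zero_or_pos k with rfl | h
  · exact hp.zero.le
  · exact (hp.mem k h).2.le

theorem rho_zero (hp : IsTransient p) : rho p 0 = 0 := by simp [rho, hp.zero]

theorem rho_nonneg (hp : IsTransient p) (k : ℕ) : 0 ≤ rho p k :=
  div_nonneg (by linarith [hp.le_one k]) (hp.pos k).le

theorem rho_pos (hp : IsTransient p) {k : ℕ} (h : 1 ≤ k) : 0 < rho p k :=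
  div_pos (by linarith [(hp.mem k h).2]) (hp.pos k)

theorem mul_rho (hp : IsTransient p) (k : ℕ) : p k * rho p k = 1 - p k := by
  rw [rho, mul_div_cancel₀ _ (hp.pos k).ne']

theorem mul_one_add_rho (hp : IsTransient p) (k : ℕ) : p k * (1 + rho p k) = 1 := by
  rw [mul_add, hp.mul_rho]; ring

theorem rhoProd_pos (hp : IsTransient p) (x y : ℕ) : 0 < rhoProd p x y :=
  Finset.prod_pos fun i hi => hp.rho_pos (by simp at hi; omega)

theorem Dfin_nonneg (hp : IsTransient p) (x y : ℕ) : 0 ≤ Dfin p x y :=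
  Finset.sum_nonneg fun j _ => (hp.rhoProd_pos x (x + j)).le

theorem Dfin_mono (hp : IsTransient p) (x : ℕ) : Monotone (Dfin p x) := fun y z h =>
  Finset.sum_le_sum_of_subset_of_nonneg (Finset.range_mono (by omega))
    fun j _ _ => (hp.rhoProd_pos x (x + j)).le

theorem one_le_Dfin (hp : IsTransient p) {x y : ℕ} (h : x < y) : 1 ≤ Dfin p x y := by
  simpa using hp.Dfin_mono x h

theorem Dfin_pos (hp : IsTransient p) {x y : ℕ} (h : x < y) : 0 < Dfin p x y :=
  one_pos.trans_le (hp.one_le_Dfin h)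

/-- The increments of D(x, ·) are the products `rhoProd`, and `p z * ρ z = 1 - p z`. All hitting
probabilities below are quotients of this function. -/
theorem Dfin_harmonic (hp : IsTransient p) {x z : ℕ} (h : x < z) :
    Dfin p x z = p z * Dfin p x (z + 1) + (1 - p z) * Dfin p x (z - 1) := by
  obtain ⟨z, rfl⟩ : ∃ y, z = y + 1 := ⟨z - 1, by omega⟩
  rw [Dfin_succ h.le, Nat.add_sub_cancel, Dfin_succ (by omega), rhoProd_succ (by omega)]
  linear_combination (-rhoProd p x z) * hp.mul_rho (z + 1)

/-- The series of D(x) is a tail of the transience series divided by `rhoProd p 0 x`, so the limit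
defining `D` exists for every x. -/
theorem tendsto_Dfin (hp : IsTransient p) (x : ℕ) : Tendsto (Dfin p x) atTop (𝓝 (D p x)) := by
  refine tendsto_nhds_limUnder ?_
  have hs : Summable fun j => rhoProd p x (x + j) := by
    have h1 : Summable fun j => rhoProd p 0 (j + x) := (summable_nat_add_iff x).2 hp.summable
    refine (h1.mul_left (rhoProd p 0 x)⁻¹).congr fun j => ?_
    rw [add_comm j x, ← rhoProd_mul (Nat.zero_le x) (Nat.le_add_right x j),
      inv_mul_cancel_left₀ (hp.rhoProd_pos 0 x).ne']
  exact ⟨_, hs.hasSum.tendsto_sum_nat.comp (tendsto_sub_atTop_nat x)⟩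

theorem Dfin_le_D (hp : IsTransient p) (x y : ℕ) : Dfin p x y ≤ D p x :=
  (hp.Dfin_mono x).ge_of_tendsto (hp.tendsto_Dfin x) y

theorem one_lt_D (hp : IsTransient p) (x : ℕ) : 1 < D p x := by
  refine lt_of_lt_of_le ?_ (hp.Dfin_le_D x (x + 2))
  rw [Dfin_succ (by omega), Dfin_self_succ]
  linarith [hp.rhoProd_pos x (x + 1)]

theorem D_pos (hp : IsTransient p) (x : ℕ) : 0 < D p x := one_pos.trans (hp.one_lt_D x)

end IsTransient

section Transience

variable {Ω : Type*} [MeasurableSpace Ω] {P : Measure Ω} {X : ℕ → Ω → ℕ}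

/-- Each site is visited finitely often: `D 0 - Dfin 0 (max z z₀)` is a bounded potential whose
only charge is at `z₀`. -/
theorem IsWalk.ae_eventually_ne [IsProbabilityMeasure P] (hX : IsWalk P p X) (hp : IsTransient p)
    (z₀ : ℕ) : ∀ᵐ ω ∂P, ∀ᶠ n in atTop, X n ω ≠ z₀ := by
  set V : ℕ → ℝ := fun z => D p 0 - Dfin p 0 (max z z₀) with hV
  -- The charge at z₀ is the probability of stepping up times the increment of D(0, ·) from z₀ to z₀
  -- + 1.
  set c : ℝ := p z₀ * rhoProd p 0 z₀ with hc
  have hcpos : 0 < c := mul_pos (hp.pos _) (hp.rhoProd_pos _ _)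
  have hV0 : ∀ z, 0 ≤ V z := fun z => sub_nonneg.2 (hp.Dfin_le_D _ _)
  have hstep : ∀ z, V z = p z * V (z + 1) + (1 - p z) * V (z - 1) + if z = z₀ then c else 0 := by
    intro z
    rcases lt_trichotomy z z₀ with h | h | h
    · have e1 : max z z₀ = z₀ := by omega
      have e2 : max (z + 1) z₀ = z₀ := by omega
      have e3 : max (z - 1) z₀ = z₀ := by omega
      simp only [hV, e1, e2, e3, if_neg h.ne]
      ring
    · subst h
      have e2 : max (z + 1) z = z + 1 := by omega
      have e3 : max (z - 1) z = z := by omega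
      simp only [hV, max_self, e2, e3, if_pos, hc]
      rw [Dfin_succ (Nat.zero_le _)]
      ring
    · have e1 : max z z₀ = z := by omega
      have e2 : max (z + 1) z₀ = z + 1 := by omega
      have e3 : max (z - 1) z₀ = z - 1 := by omega
      simp only [hV, e1, e2, e3, if_neg h.ne']
      linear_combination (-1 : ℝ) * hp.Dfin_harmonic (x := 0) (z := z) (by omega)
  have hsucc : ∀ n, ∫⁻ ω, ENNReal.ofReal (V (X n ω)) ∂P =
      ∫⁻ ω, ENNReal.ofReal (V (X (n + 1) ω)) ∂P +
        ENNReal.ofReal c * P {ω | X n ω = z₀} := by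
    intro n
    have h1 := hX.lintegral_hist_succ hp.zero n (fun l => ENNReal.ofReal (V l.headI))
    simp only [headI_hist, step, List.headI_cons] at h1
    have hms : MeasurableSet {ω | X n ω = z₀} := hX.measurable n (MeasurableSet.singleton z₀)
    rw [h1, ← lintegral_indicator_const hms, ← lintegral_add_right _
      (measurable_const.indicator hms)]
    refine lintegral_congr fun ω => ?_
    have hi : {ω | X n ω = z₀}.indicator (fun _ => ENNReal.ofReal c) ω =
        ENNReal.ofReal (if X n ω = z₀ then c else 0) := by
      by_cases h : X n ω = z₀ <;> simp [Set.indicator, h]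
    have hq : 0 ≤ 1 - p (X n ω) := by linarith [hp.le_one (X n ω)]
    rw [hi, ← ENNReal.ofReal_mul (hp.pos _).le, ← ENNReal.ofReal_mul hq,
      ← ENNReal.ofReal_add (mul_nonneg (hp.pos _).le (hV0 _)) (mul_nonneg hq (hV0 _)),
      ← ENNReal.ofReal_add (add_nonneg (mul_nonneg (hp.pos _).le (hV0 _)) (mul_nonneg hq (hV0 _)))
        (by split_ifs <;> [exact hcpos.le; exact le_rfl]), ← hstep]
  have hsum : ∀ N, ∑ n ∈ Finset.range N, ENNReal.ofReal c * P {ω | X n ω = z₀} +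
      ∫⁻ ω, ENNReal.ofReal (V (X N ω)) ∂P = ∫⁻ ω, ENNReal.ofReal (V (X 0 ω)) ∂P := by
    intro N
    induction N with
    | zero => simp
    | succ N ih =>
      rw [Finset.sum_range_succ, ← ih, hsucc N, add_assoc]
      congr 1
      exact add_comm _ _
  have hfin : ∫⁻ ω, ENNReal.ofReal (V (X 0 ω)) ∂P ≠ ∞ := by
    have : ∫⁻ ω, ENNReal.ofReal (V (X 0 ω)) ∂P = ∫⁻ ω, ENNReal.ofReal (V 0) ∂P :=
      lintegral_congr_ae (hX.start.mono fun ω h => by simp only [h])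
    rw [this]
    simp
  -- The charges released at visits to z₀ are paid by the initial potential, so the expected number
  -- of visits is finite and Borel–Cantelli applies.
  have htsum : ∑' n, P {ω | X n ω = z₀} ≠ ∞ := by
    have h1 : ∑' n, ENNReal.ofReal c * P {ω | X n ω = z₀} ≤
        ∫⁻ ω, ENNReal.ofReal (V (X 0 ω)) ∂P :=
      ENNReal.tsum_le_of_sum_range_le fun N => (le_self_add).trans_eq (hsum N)
    rw [ENNReal.tsum_mul_left] at h1
    intro h
    rw [h, ENNReal.mul_top (by simpa using hcpos)] at h1
    exact hfin (top_le_iff.1 h1)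
  have := measure_setOfPred_frequently_eq_zero htsum
  filter_upwards [measure_eq_zero_iff_ae_notMem.1 this] with ω h
  simpa using h

theorem IsWalk.ae_tendsto_atTop [IsProbabilityMeasure P] (hX : IsWalk P p X)
    (hp : IsTransient p) : ∀ᵐ ω ∂P, Tendsto (fun n => X n ω) atTop atTop := by
  filter_upwards [ae_all_iff.2 fun z => hX.ae_eventually_ne hp z] with ω h
  rw [tendsto_atTop]
  intro b
  induction b with
  | zero => exact Eventually.of_forall fun n => Nat.zero_le _
  | succ b ih =>
    filter_upwards [ih, h b] with n h1 h2
    omega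

end Transience

/-! ### Conditional probabilities given the history, and their products -/

/-- A nearest-neighbour path from `0` that tends to infinity. -/
structure Escapes (w : ℕ → ℕ) : Prop where
  isPath : ∀ n, IsPath (hist w n)
  tendsto : Tendsto w atTop atTop

/-- `Φ` is the conditional probability of `E` given the history: it is harmonic, and along escaping
paths it tends to the indicator of `E`. While the history is `low`, `Φ` does not change, and it
vanishes once the history is `dead`. -/
structure Solves (p : ℕ → ℝ) (low dead : List ℕ → Prop) (Φ : List ℕ → ℝ) (E : Set (ℕ → ℕ)) :
    Prop where
  inv : ∀ z l, IsPath (z :: l) → low (z :: l) → ∀ z', IsPath (z' :: z :: l) →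
    Φ (z' :: z :: l) = Φ (z :: l)
  harmonic : Harmonic p Φ
  eq_zero : ∀ z l, IsPath (z :: l) → dead (z :: l) → Φ (z :: l) = 0
  nonneg : ∀ l, 0 ≤ Φ l
  le_one : ∀ l, Φ l ≤ 1
  lim : ∀ w, Escapes w →
    Tendsto (fun n => Φ (hist w n)) atTop (𝓝 (E.indicator (fun _ => 1) w))

/-- The factor `G` extends a conditional probability attached to the upper site, with predicates
`low'`, `dead'` and event `E'`, to one attached to the lower site, with predicates `low`, `dead`
and event `E`. -/
structure Links (p : ℕ → ℝ) (low dead low' dead' : List ℕ → Prop) (G : List ℕ → ℝ)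
    (E E' : Set (ℕ → ℕ)) : Prop where
  mono : ∀ z l, IsPath (z :: l) → low (z :: l) → low' (z :: l)
  inv_low : ∀ z l, IsPath (z :: l) → low (z :: l) → ∀ z', IsPath (z' :: z :: l) →
    G (z' :: z :: l) = G (z :: l)
  harmonic : ∀ z l, IsPath (z :: l) → ¬ low (z :: l) → low' (z :: l) → ¬ dead' (z :: l) →
    G (z :: l) = p z * G ((z + 1) :: z :: l) + (1 - p z) * G ((z - 1) :: z :: l)
  inv_high : ∀ z l, IsPath (z :: l) → ¬ low' (z :: l) → ∀ z', IsPath (z' :: z :: l) →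
    ¬ dead' (z' :: z :: l) → G (z' :: z :: l) = G (z :: l)
  eq_zero : ∀ z l, IsPath (z :: l) → dead (z :: l) → G (z :: l) = 0 ∨ dead' (z :: l)
  nonneg : ∀ l, 0 ≤ G l
  le_one : ∀ l, G l ≤ 1
  lim : ∀ w, Escapes w → w ∈ E' →
    Tendsto (fun n => G (hist w n)) atTop (𝓝 (E.indicator (fun _ => 1) w))

theorem IsPath.up {z : ℕ} {l : List ℕ} (h : IsPath (z :: l)) : IsPath ((z + 1) :: z :: l) :=
  ⟨Or.inl rfl, h⟩

theorem IsPath.down {z : ℕ} {l : List ℕ} (h : IsPath (z :: l)) (hz : 1 ≤ z) :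
    IsPath ((z - 1) :: z :: l) :=
  ⟨Or.inr (by omega), h⟩

/-- To check harmonicity it is enough to know `Φ` after legal moves. -/
theorem harmonic_congr {p : ℕ → ℝ} (hp0 : p 0 = 1) {z : ℕ} {l : List ℕ} (h : IsPath (z :: l))
    {Φ Ψ : List ℕ → ℝ} {a b : ℝ} (hΦΨ : ∀ z', IsPath (z' :: z :: l) →
      Φ (z' :: z :: l) = a * Ψ (z' :: z :: l)) (hb : b = p z * Ψ ((z + 1) :: z :: l) +
      (1 - p z) * Ψ ((z - 1) :: z :: l)) :
    a * b = p z * Φ ((z + 1) :: z :: l) + (1 - p z) * Φ ((z - 1) :: z :: l) := by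
  rw [hΦΨ _ h.up, hb]
  -- At 0 the down move is illegal, but its weight is 0.
  rcases Nat.eq_zero_or_pos z with rfl | hz
  · simp [hp0]
  · rw [hΦΨ _ (h.down hz)]
    ring

variable {low dead low' dead' : List ℕ → Prop} {G Φ : List ℕ → ℝ}
  {E E' F : Set (ℕ → ℕ)}

/-- At each step at least one factor is constant and the other harmonic, except where Φ is already 0
(`dead'`), in which case the product stays 0 whatever G does. -/
theorem Solves.mul (hp0 : p 0 = 1) (hG : Links p low dead low' dead' G E E')
    (hΦ : Solves p low' dead' Φ F) (hF : F ⊆ E') :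
    Solves p low dead (fun l => G l * Φ l) (E ∩ F) where
  inv z l h hl z' h' := by
    rw [hG.inv_low z l h hl z' h', hΦ.inv z l h (hG.mono z l h hl) z' h']
  harmonic z l h := by
    by_cases hl : low (z :: l)
    · change G (z :: l) * Φ (z :: l) = _
      rw [mul_comm (G (z :: l))]
      refine harmonic_congr hp0 h (Φ := fun l => G l * Φ l)
          (Ψ := fun _ => G (z :: l)) (fun z' h' => ?_) (by ring)
      rw [hG.inv_low z l h hl z' h', hΦ.inv z l h (hG.mono z l h hl) z' h', mul_comm]
    · by_cases hl' : low' (z :: l)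
      · change G (z :: l) * Φ (z :: l) = _
        rw [mul_comm (G (z :: l))]
        by_cases hd : dead' (z :: l)
        · refine harmonic_congr hp0 h (Φ := fun l => G l * Φ l)
            (Ψ := fun _ => G (z :: l)) (fun z' h' => ?_) (by ring)
          rw [hΦ.inv z l h hl' z' h', hΦ.eq_zero z l h hd]
          ring
        · refine harmonic_congr hp0 h (Φ := fun l => G l * Φ l) (Ψ := G)
            (fun z' h' => ?_) (hG.harmonic z l h hl hl' hd)
          rw [hΦ.inv z l h hl' z' h', mul_comm]
      · refine harmonic_congr hp0 h (Φ := fun l => G l * Φ l) (Ψ := Φ)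
          (fun z' h' => ?_) (hΦ.harmonic z l h)
        by_cases hd : dead' (z' :: z :: l)
        · rw [hΦ.eq_zero _ _ h' hd]
          ring
        · rw [hG.inv_high z l h hl' z' h' hd]
  eq_zero z l h hd := by
    rcases hG.eq_zero z l h hd with h' | h'
    · rw [h', zero_mul]
    · rw [hΦ.eq_zero z l h h', mul_zero]
  nonneg l := mul_nonneg (hG.nonneg l) (hΦ.nonneg l)
  le_one l := mul_le_one₀ (hG.le_one l) (hΦ.nonneg l) (hΦ.le_one l)
  lim w hw := by
    have h := hΦ.lim w hw
    by_cases hwF : w ∈ F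
    · have h' := (hG.lim w hw (hF hwF)).mul h
      by_cases hwE : w ∈ E <;> simpa [hwE, hwF] using h'
    -- Off F nothing is known about the limit of G, but G is bounded and Φ tends to 0.
    · have h0 : (E ∩ F).indicator (fun _ => (1 : ℝ)) w = 0 := by simp [hwF]
      have h1 : F.indicator (fun _ => (1 : ℝ)) w = 0 := by simp [hwF]
      rw [h0]
      rw [h1] at h
      exact squeeze_zero (fun n => mul_nonneg (hG.nonneg _) (hΦ.nonneg _))
        (fun n => mul_le_of_le_one_left (hΦ.nonneg _) (hG.le_one _)) h

/-- Lets events on descents be replaced by membership in the cut sets, with which they agree only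
along escaping paths. -/
theorem Solves.congr (hΦ : Solves p low dead Φ E) (hE : ∀ w, Escapes w → (w ∈ E ↔ w ∈ F)) :
    Solves p low dead Φ F :=
  { hΦ with
    lim := fun w hw => by
      have h := hΦ.lim w hw
      by_cases hwE : w ∈ E
      · simpa [hwE, (hE w hw).1 hwE] using h
      · have hwF : w ∉ F := fun hc => hwE ((hE w hw).2 hc)
        simpa [hwE, hwF] using h }

theorem Solves.real_eq {Ω : Type*} [MeasurableSpace Ω] {P : Measure Ω} [IsProbabilityMeasure P]
    {X : ℕ → Ω → ℕ} (hp : IsTransient p) (hX : IsWalk P p X) (hΦ : Solves p low dead Φ E) :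
    NullMeasurableSet {ω | (fun k => X k ω) ∈ E} P ∧
      P.real {ω | (fun k => X k ω) ∈ E} = Φ [0] := by
  refine hX.real_eq_of_harmonic hp.zero (fun k => ⟨(hp.pos k).le, hp.le_one k⟩) hΦ.harmonic
    hΦ.nonneg hΦ.le_one ?_
  filter_upwards [hX.ae_isPath hp.zero, hX.ae_tendsto_atTop hp] with ω h1 h2
  exact hΦ.lim _ ⟨h1, h2⟩

/-! ### Conditional laws of upcrossing numbers -/

/-- Number of steps from `x + 1` down to `x` in a history. -/
def downCount (x : ℕ) : List ℕ → ℕ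
  | [] => 0
  | [_] => 0
  | a :: b :: l => downCount x (b :: l) + if a = x ∧ b = x + 1 then 1 else 0

theorem downCount_cons (x a b : ℕ) (l : List ℕ) : downCount x (a :: b :: l) =
    downCount x (b :: l) + if a = x ∧ b = x + 1 then 1 else 0 := rfl

theorem downCount_of_ne {x a b : ℕ} (l : List ℕ) (h : ¬ (a = x ∧ b = x + 1)) :
    downCount x (a :: b :: l) = downCount x (b :: l) := by
  rw [downCount_cons, if_neg h, add_zero]

theorem downCount_of_eq (x : ℕ) (l : List ℕ) :
    downCount x (x :: (x + 1) :: l) = downCount x ((x + 1) :: l) + 1 := by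
  rw [downCount_cons, if_pos ⟨rfl, rfl⟩]

theorem Escapes.eventually_downCount {w : ℕ → ℕ} (hw : Escapes w) (x : ℕ) :
    ∃ d, ∀ᶠ n in atTop, downCount x (hist w n) = d ∧ x < w n := by
  obtain ⟨N, hN⟩ := eventually_atTop.1 (hw.tendsto.eventually_gt_atTop x)
  refine ⟨downCount x (hist w N), eventually_atTop.2 ⟨N, fun n hn => ⟨?_, hN n hn⟩⟩⟩
  induction n, hn using Nat.le_induction with
  | base => rfl
  | succ n hn ih =>
    obtain ⟨l, hl⟩ := hist_eq_cons w n
    rw [← ih, hist, hl]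
    exact downCount_of_ne _ fun h => by have := hN (n + 1) (by omega); omega

/-- Weight of `a` crossings of the lower edge, given the weights `f` for a start above it. -/
def belowWeight (β : ℝ) (f : ℕ → ℝ) : ℕ → ℝ
  | 0 => 0
  | a + 1 => β * f (a + 1) + (1 - β) * belowWeight β f a

/-- Weight of `a` crossings of the lower edge and `b` further descents through the upper edge, for a
start above the upper edge. -/
def aboveWeight (α β : ℝ) : ℕ → ℕ → ℝ
  | 0 => fun a => if a = 1 then 1 else 0
  | b + 1 => fun a =>
    (1 - α) * aboveWeight α β b a + α * belowWeight β (aboveWeight α β b) (a - 1)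

section Weights

variable {α β : ℝ}

theorem belowWeight_nonneg (hβ : 0 ≤ β) (hβ' : β ≤ 1) {f : ℕ → ℝ} (hf : ∀ a, 0 ≤ f a) (a : ℕ) :
    0 ≤ belowWeight β f a := by
  induction a with
  | zero => exact le_rfl
  | succ a ih =>
    exact add_nonneg (mul_nonneg hβ (hf _)) (mul_nonneg (by linarith) ih)

theorem convex_comb_le_one {s a b : ℝ} (hs : 0 ≤ s) (hs' : s ≤ 1) (ha : a ≤ 1) (hb : b ≤ 1) :
    s * a + (1 - s) * b ≤ 1 := by
  nlinarith

theorem convex_comb_nonneg {s a b : ℝ} (hs : 0 ≤ s) (hs' : s ≤ 1) (ha : 0 ≤ a) (hb : 0 ≤ b) :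
    0 ≤ s * a + (1 - s) * b :=
  add_nonneg (mul_nonneg hs ha) (mul_nonneg (by linarith) hb)

theorem belowWeight_le_one (hβ : 0 ≤ β) (hβ' : β ≤ 1) {f : ℕ → ℝ} (hf : ∀ a, f a ≤ 1) (a : ℕ) :
    belowWeight β f a ≤ 1 := by
  induction a with
  | zero => exact zero_le_one
  | succ a ih => exact convex_comb_le_one hβ hβ' (hf _) ih

theorem aboveWeight_nonneg (hα : 0 ≤ α) (hα' : α ≤ 1) (hβ : 0 ≤ β) (hβ' : β ≤ 1) (b a : ℕ) :
    0 ≤ aboveWeight α β b a := by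
  induction b generalizing a with
  | zero => simp only [aboveWeight]; split_ifs <;> norm_num
  | succ b ih =>
    exact add_nonneg (mul_nonneg (by linarith) (ih a))
      (mul_nonneg hα (belowWeight_nonneg hβ hβ' ih _))

theorem aboveWeight_le_one (hα : 0 ≤ α) (hα' : α ≤ 1) (hβ : 0 ≤ β) (hβ' : β ≤ 1) (b a : ℕ) :
    aboveWeight α β b a ≤ 1 := by
  induction b generalizing a with
  | zero => simp only [aboveWeight]; split_ifs <;> norm_num
  | succ b ih =>
    simp only [aboveWeight]
    rw [add_comm]
    exact convex_comb_le_one hα hα' (belowWeight_le_one hβ hβ' ih _) (ih a)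

theorem aboveWeight_zero_right (b : ℕ) : aboveWeight α β b 0 = 0 := by
  induction b with
  | zero => simp [aboveWeight]
  | succ b ih => simp [aboveWeight, ih, belowWeight]

end Weights

/-- Probability that the walk started at `x + 1` reaches `y + 1` before `x`. -/
def betaUp (p : ℕ → ℝ) (x y : ℕ) : ℝ := 1 / Dfin p x (y + 1)

/-- Probability that the walk started at `y` reaches `x` before `y + 1`. -/
def alphaDown (p : ℕ → ℝ) (x y : ℕ) : ℝ := 1 - Dfin p x y / Dfin p x (y + 1)

/-- Probability of `t` upcrossings of `x` given `u` upcrossings of `y ≥ x`. -/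
def upTrans (p : ℕ → ℝ) (x t y u : ℕ) : ℝ :=
  if x = y then if t = u then 1 else 0
  else belowWeight (betaUp p x y) (aboveWeight (alphaDown p x y) (betaUp p x y) (u - 1)) t

/-- Weight of `a` crossings of `x` and `b` crossings of `y` still to be made by a walk at `z`. -/
def upLinkAux (p : ℕ → ℝ) (x y a b z : ℕ) : ℝ :=
  if z ≤ x then
    belowWeight (betaUp p x y) (aboveWeight (alphaDown p x y) (betaUp p x y) (b - 1)) a
  else if y < z then aboveWeight (alphaDown p x y) (betaUp p x y) (b - 1) a
  else
    Dfin p x z / Dfin p x (y + 1) * aboveWeight (alphaDown p x y) (betaUp p x y) (b - 1) a +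
      (1 - Dfin p x z / Dfin p x (y + 1)) *
        belowWeight (betaUp p x y) (aboveWeight (alphaDown p x y) (betaUp p x y) (b - 1)) (a - 1)

/-- Conditional version of `upTrans` given the history. -/
def upLink (p : ℕ → ℝ) (x t y u : ℕ) (l : List ℕ) : ℝ :=
  upLinkAux p x y (t - downCount x l) (u - downCount y l) l.headI

/-- Probability of `u` upcrossings of `y`. -/
def upLast (p : ℕ → ℝ) (y : ℕ) : ℕ → ℝ
  | 0 => 0
  | u + 1 => (1 - 1 / D p y) ^ u * (1 / D p y)

/-- Weight of `b` crossings of `y` still to be made by a walk at `z`. -/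
def upFinalAux (p : ℕ → ℝ) (y b z : ℕ) : ℝ :=
  if z ≤ y then upLast p y b
  else Dfin p y z / D p y * (if b = 1 then 1 else 0) +
    (1 - Dfin p y z / D p y) * upLast p y (b - 1)

/-- Conditional version of `upLast` given the history. -/
def upFinal (p : ℕ → ℝ) (y u : ℕ) (l : List ℕ) : ℝ :=
  upFinalAux p y (u - downCount y l) l.headI

/-- The walk is at or below `x`. -/
def upLow (x : ℕ) (l : List ℕ) : Prop := l.headI ≤ x

/-- More than `t - 1` descents from `x + 1` to `x` have been made. -/
def upDead (x t : ℕ) (l : List ℕ) : Prop := t ≤ downCount x l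

/-- Paths with exactly `t` upcrossings of `x`, counted through the descents. -/
def upEvent (x t : ℕ) : Set (ℕ → ℕ) := {w | ∀ᶠ n in atTop, downCount x (hist w n) + 1 = t}

namespace IsTransient

theorem betaUp_pos (hp : IsTransient p) (x y : ℕ) (h : x ≤ y) : 0 < betaUp p x y :=
  one_div_pos.2 (hp.Dfin_pos (by omega))

theorem betaUp_le_one (hp : IsTransient p) (x y : ℕ) (h : x ≤ y) : betaUp p x y ≤ 1 := by
  rw [betaUp, div_le_one (hp.Dfin_pos (by omega))]
  exact hp.one_le_Dfin (by omega)

theorem ratio_mem (hp : IsTransient p) (x y z : ℕ) (hz : z ≤ y) :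
    0 ≤ Dfin p x z / Dfin p x y ∧ Dfin p x z / Dfin p x y ≤ 1 :=
  ⟨div_nonneg (hp.Dfin_nonneg _ _) (hp.Dfin_nonneg _ _),
    div_le_one_of_le₀ (hp.Dfin_mono x hz) (hp.Dfin_nonneg _ _)⟩

theorem ratio_mem_D (hp : IsTransient p) (x z : ℕ) :
    0 ≤ Dfin p x z / D p x ∧ Dfin p x z / D p x ≤ 1 :=
  ⟨div_nonneg (hp.Dfin_nonneg _ _) (hp.D_pos _).le,
    div_le_one_of_le₀ (hp.Dfin_le_D _ _) (hp.D_pos _).le⟩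

theorem alphaDown_nonneg (hp : IsTransient p) (x y : ℕ) : 0 ≤ alphaDown p x y :=
  sub_nonneg.2 (hp.ratio_mem x (y + 1) y (by omega)).2

theorem alphaDown_le_one (hp : IsTransient p) (x y : ℕ) : alphaDown p x y ≤ 1 := by
  have := (hp.ratio_mem x (y + 1) y (by omega)).1
  rw [alphaDown]
  linarith

/-- Needed when the prescriptions of C(a, b) at two sites meet at a common level: they are then
either identical or contradictory. -/
theorem _root_.CutWalk.links_up_self (y t u : ℕ) :
    Links p (upLow y) (upDead y t) (upLow y) (upDead y u)
    (fun _ => if t = u then 1 else 0) (upEvent y t) (upEvent y u) where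
  mono z l _ h := h
  inv_low z l _ _ z' _ := rfl
  harmonic z l _ h h' := absurd h' h
  inv_high z l _ _ z' _ _ := rfl
  eq_zero z l h hd := by
    by_cases htu : t = u
    · right; rwa [← htu]
    · left; simp [htu]
  nonneg l := by split_ifs <;> norm_num
  le_one l := by split_ifs <;> norm_num
  lim w hw hE := by
    refine tendsto_const_nhds.congr' (Eventually.of_forall fun n => ?_)
    by_cases htu : t = u
    · subst htu; simp [hE]
    · have : w ∉ upEvent y t := fun h => by
        obtain ⟨n, h1, h2⟩ := (h.and hE).exists
        omega
      simp [htu, this]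

/-- Between x and y the walk exits at y + 1 or at x with gambler's ruin probabilities, so the link
interpolates along D(x, ·) between the weights of these two exits; an exit at x uses up one
crossing. Descents through y are prescribed by the upper event and hence are not averaged over: the
recursion of `aboveWeight` makes the link unchanged by them. -/
theorem links_up (hp : IsTransient p) {x y : ℕ} (hxy : x < y) (t u : ℕ) :
    Links p (upLow x) (upDead x t) (upLow y) (upDead y u) (upLink p x t y u)
      (upEvent x t) (upEvent y u) := by
  have hβ := (hp.betaUp_pos x y hxy.le).le
  have hβ' := hp.betaUp_le_one x y hxy.le
  have hα := hp.alphaDown_nonneg x y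
  have hα' := hp.alphaDown_le_one x y
  have hf := aboveWeight_nonneg hα hα' hβ hβ'
  have hf' := aboveWeight_le_one hα hα' hβ hβ'
  have hD : Dfin p x (y + 1) ≠ 0 := (hp.Dfin_pos (by omega)).ne'
  refine
    { mono := fun z l _ h => le_trans h hxy.le
      inv_low := ?_
      harmonic := ?_
      inv_high := ?_
      eq_zero := ?_
      nonneg := ?_
      le_one := ?_
      lim := ?_ }
  · intro z l h hl z' h'
    have hz : z ≤ x := hl
    have e1 : downCount y (z' :: z :: l) = downCount y (z :: l) :=
      downCount_of_ne _ (by omega)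
    have e2 : downCount x (z' :: z :: l) = downCount x (z :: l) :=
      downCount_of_ne _ (by omega)
    simp only [upLink, e1, e2, List.headI_cons]
    simp only [upLinkAux]
    rw [if_pos hz]
    by_cases hz' : z' ≤ x
    · rw [if_pos hz']
    · have : z' = x + 1 := by have := h'.1; omega
      subst this
      rw [if_neg hz', if_neg (by omega), Dfin_self_succ]
      -- The value at x + 1 is the defining recursion of `belowWeight`.
      change betaUp p x y * _ + (1 - betaUp p x y) * _ = _
      cases t - downCount x (z :: l) with
      | zero => simp [aboveWeight_zero_right, belowWeight]
      | succ a => simp [belowWeight]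
  · intro z l h hl hl' hd
    have hz : x < z := not_le.1 hl
    have hz' : z ≤ y := hl'
    have e1 : downCount y ((z + 1) :: z :: l) = downCount y (z :: l) :=
      downCount_of_ne _ (by omega)
    have e2 : downCount x ((z + 1) :: z :: l) = downCount x (z :: l) :=
      downCount_of_ne _ (by omega)
    have e3 : downCount y ((z - 1) :: z :: l) = downCount y (z :: l) :=
      downCount_of_ne _ (by omega)
    set f := aboveWeight (alphaDown p x y) (betaUp p x y) (u - downCount y (z :: l) - 1) with hfdef
    set a := t - downCount x (z :: l) with ha
    have h0 : upLink p x t y u (z :: l) = Dfin p x z / Dfin p x (y + 1) * f a +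
        (1 - Dfin p x z / Dfin p x (y + 1)) * belowWeight (betaUp p x y) f (a - 1) := by
      simp only [upLink, List.headI_cons]
      simp only [upLinkAux]
      rw [if_neg (by omega), if_neg (by omega)]
    have h1 : upLink p x t y u ((z + 1) :: z :: l) = Dfin p x (z + 1) / Dfin p x (y + 1) * f a +
        (1 - Dfin p x (z + 1) / Dfin p x (y + 1)) * belowWeight (betaUp p x y) f (a - 1) := by
      simp only [upLink, List.headI_cons, e1, e2]
      simp only [upLinkAux]
      rw [if_neg (by omega)]
      by_cases hzy : z = y
      -- At y + 1 the definition switches branch; both branches agree because the exit probability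
      -- is 1 there.
      · subst hzy
        rw [if_pos (by omega), div_self hD]
        ring
      · rw [if_neg (by omega)]
    have h2 : upLink p x t y u ((z - 1) :: z :: l) = Dfin p x (z - 1) / Dfin p x (y + 1) * f a +
        (1 - Dfin p x (z - 1) / Dfin p x (y + 1)) * belowWeight (betaUp p x y) f (a - 1) := by
      simp only [upLink, List.headI_cons, e3]
      simp only [upLinkAux]
      by_cases hzx : z = x + 1
      · subst hzx
        -- The step down to x is itself counted, which gives the `a - 1`, and D(x, x) = 0 leaves
        -- only that term.
        rw [Nat.add_sub_cancel, downCount_of_eq, if_pos le_rfl, Dfin_self, Nat.sub_add_eq]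
        simp [← ha, ← hfdef]
      · rw [if_neg (by omega), if_neg (by omega), downCount_of_ne _ (by omega)]
    rw [h0, h1, h2]
    have := hp.Dfin_harmonic hz
    field_simp
    linear_combination (f a - belowWeight (betaUp p x y) f (a - 1)) * this
  · intro z l h hl z' h' hd
    have hz : y < z := not_le.1 hl
    have hz'1 := h'.1
    have e2 : downCount x (z' :: z :: l) = downCount x (z :: l) :=
      downCount_of_ne _ (by omega)
    simp only [upLink, e2, List.headI_cons]
    simp only [upLinkAux]
    rw [if_neg (show ¬ z ≤ x by omega), if_pos hz, if_neg (by omega)]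
    by_cases hzy : y < z'
    · rw [if_pos hzy, downCount_of_ne _ (by omega)]
    · obtain rfl : z' = y := by omega
      obtain rfl : z = z' + 1 := by omega
      -- Not being dead after this descent keeps the truncated number of remaining descents
      -- faithful, so it really drops from b + 1 to b.
      simp only [upDead, downCount_of_eq, not_le] at hd
      rw [if_neg hzy, downCount_of_eq]
      obtain ⟨b, hb⟩ : ∃ b, u = downCount z' ((z' + 1) :: l) + 1 + 1 + b := ⟨_, (by omega : u =
        downCount z' ((z' + 1) :: l) + 1 + 1 + (u - (downCount z' ((z' + 1) :: l) + 1 + 1)))⟩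
      have i1 : u - (downCount z' ((z' + 1) :: l) + 1) - 1 = b := by omega
      have i2 : u - downCount z' ((z' + 1) :: l) - 1 = b + 1 := by omega
      rw [i1, i2, aboveWeight, alphaDown]
      ring
  · intro z l h hd
    left
    have : t - downCount x (z :: l) = 0 := Nat.sub_eq_zero_of_le hd
    simp only [upLink, this, List.headI_cons]
    simp only [upLinkAux]
    simp [belowWeight, aboveWeight_zero_right]
  · intro l
    simp only [upLink]
    simp only [upLinkAux]
    split_ifs with h1 h2
    · exact belowWeight_nonneg hβ hβ' (hf _) _
    · exact hf _ _
    · obtain ⟨h3, h4⟩ := hp.ratio_mem x (y + 1) l.headI (by omega)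
      exact convex_comb_nonneg h3 h4 (hf _ _) (belowWeight_nonneg hβ hβ' (hf _) _)
  · intro l
    simp only [upLink]
    simp only [upLinkAux]
    split_ifs with h1 h2
    · exact belowWeight_le_one hβ hβ' (hf' _) _
    · exact hf' _ _
    · obtain ⟨h3, h4⟩ := hp.ratio_mem x (y + 1) l.headI (by omega)
      exact convex_comb_le_one h3 h4 (hf' _ _) (belowWeight_le_one hβ hβ' (hf' _) _)
  · intro w hw hE
    obtain ⟨d, hd⟩ := hw.eventually_downCount x
    refine tendsto_const_nhds.congr' ?_
    have hE' : ∀ᶠ n in atTop, downCount y (hist w n) + 1 = u := hE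
    have hwE : w ∈ upEvent x t ↔ d + 1 = t := by
      constructor
      · intro h
        obtain ⟨n, h1, h2⟩ := (hd.and h).exists
        omega
      · intro h
        exact hd.mono fun n hn => by omega
    filter_upwards [hd, hE', hw.tendsto.eventually_gt_atTop y] with n h1 h2 h3
    have i1 : u - downCount y (hist w n) - 1 = 0 := by omega
    simp only [upLink, headI_hist]
    simp only [upLinkAux]
    rw [if_neg (by omega), if_pos h3, h1.1, i1]
    simp only [aboveWeight]
    by_cases h : d + 1 = t
    · rw [if_pos (by omega), Set.indicator_of_mem (hwE.2 h)]
    · rw [if_neg (by omega), Set.indicator_of_notMem (fun hc => h (hwE.1 hc))]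

theorem upLast_nonneg (hp : IsTransient p) (y u : ℕ) : 0 ≤ upLast p y u := by
  cases u with
  | zero => exact le_rfl
  | succ u =>
    have : 1 / D p y ≤ 1 := (div_le_one (hp.D_pos y)).2 (hp.one_lt_D y).le
    exact mul_nonneg (pow_nonneg (by linarith) _) (one_div_pos.2 (hp.D_pos y)).le

theorem upLast_le_one (hp : IsTransient p) (y u : ℕ) : upLast p y u ≤ 1 := by
  cases u with
  | zero => exact zero_le_one
  | succ u =>
    have h1 : 1 / D p y ≤ 1 := (div_le_one (hp.D_pos y)).2 (hp.one_lt_D y).le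
    have h2 : 0 ≤ 1 / D p y := (one_div_pos.2 (hp.D_pos y)).le
    exact mul_le_one₀ (pow_le_one₀ (by linarith) (by linarith)) h2 h1

/-- The geometric recursion: from y + 1 the walk never returns to y with probability 1 / D(y). -/
theorem _root_.CutWalk.upFinal_up (y u : ℕ) : upLast p y u =
    1 / D p y * (if u = 1 then 1 else 0) + (1 - 1 / D p y) * upLast p y (u - 1) := by
  rcases u with _ | _ | u
  · simp [upLast]
  · simp [upLast]
  · simp [upLast]
    ring

theorem tendsto_ratio (hp : IsTransient p) (y : ℕ) :
    Tendsto (fun z => Dfin p y z / D p y) atTop (𝓝 1) := by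
  have := (hp.tendsto_Dfin y).div_const (D p y)
  rwa [div_self (hp.D_pos y).ne'] at this

/-- The same interpolation as in `links_up`, with infinity as the upper exit: `Dfin p y z / D p y`
is the probability of escape from z without hitting y. -/
theorem solves_up (hp : IsTransient p) (y u : ℕ) :
    Solves p (upLow y) (upDead y u) (upFinal p y u) (upEvent y u) := by
  have hD := (hp.D_pos y).ne'
  have inv : ∀ z l, IsPath (z :: l) → upLow y (z :: l) → ∀ z', IsPath (z' :: z :: l) →
      upFinal p y u (z' :: z :: l) = upFinal p y u (z :: l) := by
    intro z l h hl z' h'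
    have hz : z ≤ y := hl
    simp only [upFinal, downCount_of_ne (x := y) (a := z') (b := z) l (by omega), List.headI_cons]
    simp only [upFinalAux]
    rw [if_pos hz]
    by_cases hz' : z' ≤ y
    · rw [if_pos hz']
    · obtain rfl : z' = y + 1 := by have := h'.1; omega
      rw [if_neg hz', Dfin_self_succ, ← upFinal_up]
  refine
    { inv := inv
      harmonic := ?_
      eq_zero := ?_
      nonneg := ?_
      le_one := ?_
      lim := ?_ }
  · intro z l h
    by_cases hz : z ≤ y
    · rw [← one_mul (upFinal p y u (z :: l))]
      refine harmonic_congr hp.zero h (Ψ := fun _ => upFinal p y u (z :: l)) (fun z' h' => ?_)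
        (by ring)
      rw [inv z l h hz z' h', one_mul]
    · push Not at hz
      set b := u - downCount y (z :: l) with hb
      have h0 : upFinal p y u (z :: l) = Dfin p y z / D p y * (if b = 1 then 1 else 0) +
          (1 - Dfin p y z / D p y) * upLast p y (b - 1) := by
        simp only [upFinal, List.headI_cons]
        simp only [upFinalAux]
        rw [if_neg hz.not_ge]
      have h1 : upFinal p y u ((z + 1) :: z :: l) =
          Dfin p y (z + 1) / D p y * (if b = 1 then 1 else 0) +
          (1 - Dfin p y (z + 1) / D p y) * upLast p y (b - 1) := by
        simp only [upFinal, List.headI_cons]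
        simp only [upFinalAux]
        rw [if_neg (show ¬ z + 1 ≤ y by omega), downCount_of_ne _ (by omega)]
      have h2 : upFinal p y u ((z - 1) :: z :: l) =
          Dfin p y (z - 1) / D p y * (if b = 1 then 1 else 0) +
          (1 - Dfin p y (z - 1) / D p y) * upLast p y (b - 1) := by
        simp only [upFinal, List.headI_cons]
        simp only [upFinalAux]
        by_cases hzy : z = y + 1
        · subst hzy
          rw [Nat.add_sub_cancel, if_pos le_rfl, downCount_of_eq, Dfin_self, Nat.sub_add_eq, ← hb]
          simp
        · rw [if_neg (show ¬ z - 1 ≤ y by omega), downCount_of_ne _ (by omega)]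
      rw [h0, h1, h2]
      have := hp.Dfin_harmonic hz
      generalize (if b = 1 then (1 : ℝ) else 0) = c
      field_simp
      linear_combination (c - upLast p y (b - 1)) * this
  · intro z l h hd
    have : u - downCount y (z :: l) = 0 := Nat.sub_eq_zero_of_le hd
    simp [upFinal, upFinalAux, this, upLast]
  · intro l
    simp only [upFinal]
    simp only [upFinalAux]
    obtain ⟨h3, h4⟩ := hp.ratio_mem_D y l.headI
    split_ifs
    · exact hp.upLast_nonneg _ _
    · exact convex_comb_nonneg h3 h4 zero_le_one (hp.upLast_nonneg _ _)
    · exact convex_comb_nonneg h3 h4 le_rfl (hp.upLast_nonneg _ _)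
  · intro l
    simp only [upFinal]
    simp only [upFinalAux]
    obtain ⟨h3, h4⟩ := hp.ratio_mem_D y l.headI
    split_ifs
    · exact hp.upLast_le_one _ _
    · exact convex_comb_le_one h3 h4 le_rfl (hp.upLast_le_one _ _)
    · exact convex_comb_le_one h3 h4 zero_le_one (hp.upLast_le_one _ _)
  · intro w hw
    obtain ⟨d, hd⟩ := hw.eventually_downCount y
    have hwE : w ∈ upEvent y u ↔ d + 1 = u := by
      constructor
      · intro h
        obtain ⟨n, h1, h2⟩ := (hd.and h).exists
        omega
      · intro h
        exact hd.mono fun n hn => by omega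
    have hr := (hp.tendsto_ratio y).comp hw.tendsto
    have hlim := (hr.mul_const (if u - d = 1 then (1 : ℝ) else 0)).add
      ((hr.const_sub 1).mul_const (upLast p y (u - d - 1)))
    have hval : (1 : ℝ) * (if u - d = 1 then (1 : ℝ) else 0) + (1 - 1) * upLast p y (u - d - 1) =
        (upEvent y u).indicator (fun _ => 1) w := by
      by_cases h : d + 1 = u
      · rw [if_pos (by omega), Set.indicator_of_mem (hwE.2 h)]
        ring
      · rw [if_neg (by omega), Set.indicator_of_notMem (fun hc => h (hwE.1 hc))]
        ring
    rw [hval] at hlim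
    refine hlim.congr' ?_
    filter_upwards [hd] with n h1
    simp only [upFinal, headI_hist, h1.1, Function.comp]
    simp only [upFinalAux]
    rw [if_neg h1.2.not_ge]

end IsTransient

/-! ### Local times and upcrossing times in terms of descents -/

theorem isPath_hist_succ {w : ℕ → ℕ} {n : ℕ} (h : IsPath (hist w (n + 1))) :
    (w (n + 1) = w n + 1 ∨ w n = w (n + 1) + 1) ∧ IsPath (hist w n) := by
  obtain ⟨l, hl⟩ := hist_eq_cons w n
  rw [hist, hl] at h
  rw [hl]
  exact h

theorem Escapes.start {w : ℕ → ℕ} (hw : Escapes w) : w 0 = 0 := hw.isPath 0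

theorem Escapes.move {w : ℕ → ℕ} (hw : Escapes w) (n : ℕ) :
    w (n + 1) = w n + 1 ∨ w n = w (n + 1) + 1 := (isPath_hist_succ (hw.isPath (n + 1))).1

theorem downCount_hist_succ (w : ℕ → ℕ) (x n : ℕ) : downCount x (hist w (n + 1)) =
    downCount x (hist w n) + if w (n + 1) = x ∧ w n = x + 1 then 1 else 0 := by
  obtain ⟨l, hl⟩ := hist_eq_cons w n
  rw [hist, hl, downCount_cons]

/-- Ups and downs through an edge alternate, beginning with an up because the path starts at 0 ≤ x.
-/
theorem Escapes.sum_up {w : ℕ → ℕ} (hw : Escapes w) (x n : ℕ) :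
    (∑ k ∈ Finset.range n, if w k = x ∧ w (k + 1) = x + 1 then 1 else 0) =
      downCount x (hist w n) + if x < w n then 1 else 0 := by
  induction n with
  | zero => simp [hist, downCount, hw.start]
  | succ n ih =>
    rw [Finset.sum_range_succ, ih, downCount_hist_succ]
    have := hw.move n
    split_ifs <;> omega

theorem Escapes.sum_visit_zero {w : ℕ → ℕ} (hw : Escapes w) (n : ℕ) :
    (∑ k ∈ Finset.range n, if w k = 0 then 1 else 0) =
      ∑ k ∈ Finset.range n, if w k = 0 ∧ w (k + 1) = 0 + 1 then 1 else 0 := by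
  refine Finset.sum_congr rfl fun k _ => ?_
  have := hw.move k
  split_ifs <;> omega

/-- Every visit to x + 1 before time n is followed by a step up or by a descent to x. -/
theorem Escapes.sum_visit_succ {w : ℕ → ℕ} (hw : Escapes w) (x n : ℕ) :
    (∑ k ∈ Finset.range n, if w k = x + 1 then 1 else 0) =
      (∑ k ∈ Finset.range n, if w k = x + 1 ∧ w (k + 1) = x + 1 + 1 then 1 else 0) +
        downCount x (hist w n) := by
  induction n with
  | zero => simp [hist, downCount]
  | succ n ih =>
    rw [Finset.sum_range_succ, ih, Finset.sum_range_succ, downCount_hist_succ]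
    have := hw.move n
    split_ifs <;> omega

theorem encard_eq_of_eventually_sum {Q : ℕ → Prop} [DecidablePred Q] {c : ℕ}
    (hfin : ∀ᶠ k in atTop, ¬ Q k)
    (hsum : ∀ᶠ n in atTop, (∑ k ∈ Finset.range n, if Q k then 1 else 0) = c) :
    Set.encard {k | Q k} = c := by
  obtain ⟨N, hN⟩ := eventually_atTop.1 hfin
  obtain ⟨n, hn, hc⟩ := ((eventually_ge_atTop N).and hsum).exists
  have : {k | Q k} = ((Finset.range n).filter Q : Set ℕ) := by
    ext k
    simp only [Set.mem_ofPred_eq, Finset.coe_filter, Finset.mem_range]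
    exact ⟨fun h => ⟨by by_contra hk; exact hN k (by omega) h, h⟩, fun h => h.2⟩
  rw [this, Set.encard_coe_eq_coe_finsetCard, Finset.card_filter, hc]

/-- Along an escaping path the number `d x` of descents from `x + 1` to `x` determines the local and
upcrossing times. -/
theorem Escapes.exists_descents {w : ℕ → ℕ} (hw : Escapes w) : ∃ d : ℕ → ℕ,
    (∀ x t, w ∈ upEvent x t ↔ d x + 1 = t) ∧ (∀ x, upTime w x = (d x + 1 : ℕ)) ∧
    localTime w 0 = (d 0 + 1 : ℕ) ∧ ∀ x, localTime w (x + 1) = (d x + d (x + 1) + 1 : ℕ) := by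
  choose d hd using hw.eventually_downCount
  have hne : ∀ x, ∀ᶠ k in atTop, w k ≠ x := fun x =>
    (hw.tendsto.eventually_gt_atTop x).mono fun k hk => ne_of_gt hk
  have hup : ∀ x, ∀ᶠ n in atTop,
      (∑ k ∈ Finset.range n, if w k = x ∧ w (k + 1) = x + 1 then 1 else 0) = d x + 1 := by
    intro x
    filter_upwards [hd x] with n hn
    rw [hw.sum_up, hn.1, if_pos hn.2]
  refine ⟨d, fun x t => ⟨fun h => ?_, fun h => ?_⟩, fun x => ?_, ?_, fun x => ?_⟩
  · obtain ⟨n, h1, h2⟩ := ((hd x).and h).exists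
    omega
  · exact (hd x).mono fun n hn => by omega
  · exact encard_eq_of_eventually_sum ((hne x).mono fun k hk h => hk h.1) (hup x)
  · refine encard_eq_of_eventually_sum (hne 0) ?_
    filter_upwards [hup 0] with n hn
    rw [hw.sum_visit_zero, hn]
  · refine encard_eq_of_eventually_sum (hne (x + 1)) ?_
    filter_upwards [hup (x + 1), hd x] with n hn hn'
    rw [hw.sum_visit_succ, hn, hn'.1]
    ring

/-- The condition on the local time is automatic: it is finite and at least the upcrossing time. -/
theorem Escapes.mem_sites_up {w : ℕ → ℕ} (hw : Escapes w) (a x : ℕ) :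
    x ∈ (CutClass.up a).sites w ↔ w ∈ upEvent x a := by
  obtain ⟨d, h1, h2, h3, h4⟩ := hw.exists_descents
  rw [h1]
  simp only [CutClass.sites, cutSet, Set.mem_ofPred_eq, Set.mem_singleton_iff, exists_eq_left, h2,
    Nat.cast_inj]
  refine ⟨fun h => h.2, fun h => ⟨?_, h⟩⟩
  cases x with
  | zero => exact ⟨_, h.ge, h3⟩
  | succ x => exact ⟨_, by omega, h4 x⟩

/-- Number of upcrossings that `C(a, b) ∋ x` forces at the site `x - 1` preceding `x`. At `x = 0`
the truncated predecessor is `0` itself. -/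
def preTarget (a b x : ℕ) : ℕ := if x = 0 then a else a - b + 1

/-- For x ≥ 1, a visits with b upcrossings leave a - b descents from x to x - 1. At 0 both
prescriptions concern the site 0 and express that all jumps from 0 go up, which forces a = b. -/
theorem Escapes.mem_sites_both {w : ℕ → ℕ} (hw : Escapes w) {a b : ℕ} (hab : b ≤ a) (x : ℕ) :
    x ∈ (CutClass.both a b).sites w ↔
      w ∈ upEvent (x - 1) (preTarget a b x) ∩ upEvent x b := by
  obtain ⟨d, h1, h2, h3, h4⟩ := hw.exists_descents
  rw [Set.mem_inter_iff, h1, h1]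
  simp only [CutClass.sites, cutSet, Set.mem_ofPred_eq, Set.mem_singleton_iff, exists_eq_left, h2,
    Nat.cast_inj]
  cases x with
  | zero => simp only [h3, Nat.cast_inj, preTarget, if_true, Nat.zero_sub]
  | succ x =>
    simp only [h4, Nat.cast_inj, preTarget, Nat.add_sub_cancel, Nat.succ_ne_zero, if_false]
    omega

/-! ### Conditional laws of weak cutpoints -/

/-- Paths that never go below `x` after having been above `x`. -/
def weakEvent (x : ℕ) : Set (ℕ → ℕ) := {w | ∀ i j, i < j → x < w i → x ≤ w j}

theorem Escapes.mem_sites_weak {w : ℕ → ℕ} (hw : Escapes w) (x : ℕ) :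
    x ∈ CutClass.weak.sites w ↔ w ∈ weakEvent x := by
  constructor
  · rintro ⟨k, h1, h2, h3⟩ i j hij hi
    have : k ≤ i := by
      by_contra hc
      exact absurd (h2 i (by omega)) (by omega)
    exact h3 j (by omega)
  · intro h
    -- The witness k is the time just before the first passage above x.
    have hex : ∃ m, x < w m := (hw.tendsto.eventually_gt_atTop x).exists
    classical
    have hm := Nat.find_spec hex
    have hlt : ∀ i < Nat.find hex, w i ≤ x := fun i hi => not_lt.1 (Nat.find_min hex hi)
    generalize Nat.find hex = m at *
    obtain ⟨k, rfl⟩ : ∃ k, m = k + 1 := by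
      cases m with
      | zero => rw [hw.start] at hm; omega
      | succ k => exact ⟨k, rfl⟩
    have hk : w k = x := by
      have := hw.move k
      have := hlt k (by omega)
      omega
    refine ⟨k, hk, fun i hi => hlt i (by omega), fun i hi => ?_⟩
    rcases (Nat.succ_le_of_lt hi).eq_or_lt with h' | h'
    · subst h'; exact hm.le
    · exact h _ _ h' hm

/-- The walk has not yet been above `x`. -/
def weakLow (x : ℕ) (l : List ℕ) : Prop := ∀ a ∈ l, a ≤ x

/-- The walk has been below `x` after having been above `x`. -/
def weakDead (x : ℕ) : List ℕ → Prop
  | [] => False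
  | a :: l => weakDead x l ∨ a < x ∧ ¬ weakLow x l

theorem weakLow_cons {x a : ℕ} {l : List ℕ} : weakLow x (a :: l) ↔ a ≤ x ∧ weakLow x l := by
  simp [weakLow]

theorem weakDead_cons {x a : ℕ} {l : List ℕ} :
    weakDead x (a :: l) ↔ weakDead x l ∨ a < x ∧ ¬ weakLow x l := Iff.rfl

theorem weakDead.not_low {x : ℕ} {l : List ℕ} (h : weakDead x l) : ¬ weakLow x l := by
  induction l with
  | nil => exact h.elim
  | cons a l ih =>
    rw [weakLow_cons]
    rcases h with h | h
    · exact fun hc => ih h hc.2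
    · exact fun hc => h.2 hc.2

theorem weakLow_mono {x y : ℕ} (hxy : x ≤ y) {l : List ℕ} (h : weakLow x l) : weakLow y l :=
  fun a ha => (h a ha).trans hxy

theorem le_of_not_weakDead {x z : ℕ} {l : List ℕ} (h : ¬ weakLow x (z :: l))
    (hd : ¬ weakDead x (z :: l)) : x ≤ z := by
  rw [weakLow_cons] at h
  rw [weakDead_cons] at hd
  by_contra hc
  exact hd (Or.inr ⟨by omega, fun hl => h ⟨by omega, hl⟩⟩)

theorem weakLow_hist {w : ℕ → ℕ} {x n : ℕ} : weakLow x (hist w n) ↔ ∀ i ≤ n, w i ≤ x := by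
  induction n with
  | zero => simp [hist, weakLow]
  | succ n ih =>
    rw [hist, weakLow_cons, ih]
    refine ⟨fun h i hi => ?_, fun h => ⟨h _ le_rfl, fun i hi => h i (by omega)⟩⟩
    rcases Nat.lt_or_ge n i with h' | h'
    · obtain rfl : i = n + 1 := by omega
      exact h.1
    · exact h.2 i h'

theorem weakDead_hist {w : ℕ → ℕ} {x n : ℕ} : weakDead x (hist w n) ↔
    ∃ i j, i < j ∧ j ≤ n ∧ x < w i ∧ w j < x := by
  induction n with
  | zero =>
    simp only [hist, weakDead_cons, weakDead, weakLow]
    constructor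
    · simp
    · rintro ⟨i, j, h1, h2, -⟩; omega
  | succ n ih =>
    rw [hist, weakDead_cons, ih, weakLow_hist]
    constructor
    · rintro (⟨i, j, h1, h2, h3⟩ | ⟨h1, h2⟩)
      · exact ⟨i, j, h1, by omega, h3⟩
      · push Not at h2
        obtain ⟨i, hi, hi'⟩ := h2
        exact ⟨i, n + 1, by omega, le_rfl, hi', h1⟩
    · rintro ⟨i, j, h1, h2, h3, h4⟩
      rcases Nat.lt_or_ge n j with h' | h'
      · obtain rfl : j = n + 1 := by omega
        exact Or.inr ⟨h4, fun h => absurd (h i (by omega)) (by omega)⟩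
      · exact Or.inl ⟨i, j, h1, h', h3, h4⟩

theorem not_mem_weakEvent {w : ℕ → ℕ} {x : ℕ} (h : w ∉ weakEvent x) :
    ∀ᶠ n in atTop, weakDead x (hist w n) := by
  simp only [weakEvent, Set.mem_ofPred_eq] at h
  push Not at h
  obtain ⟨i, j, h1, h2, h3⟩ := h
  filter_upwards [eventually_ge_atTop j] with n hn
  exact weakDead_hist.2 ⟨i, j, h1, hn, h2, h3⟩

theorem mem_weakEvent {w : ℕ → ℕ} {x : ℕ} (h : w ∈ weakEvent x) (n : ℕ) :
    ¬ weakDead x (hist w n) := by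
  rw [weakDead_hist]
  rintro ⟨i, j, h1, -, h2, h3⟩
  exact absurd (h i j h1 h2) (by omega)

/-- Probability that the walk started at `x + 1` reaches `y + 1` before `x - 1`. -/
def weakTrans (p : ℕ → ℝ) (x y : ℕ) : ℝ := (1 + rho p x) / (1 + rho p x * Dfin p x (y + 1))

/-- Probability that the walk started at `y + 1` never reaches `y - 1`. -/
def weakLast (p : ℕ → ℝ) (y : ℕ) : ℝ := (1 + rho p y) / (1 + rho p y * D p y)

open Classical in
/-- Conditional version of `weakTrans` given the history. -/
def weakLink (p : ℕ → ℝ) (x y : ℕ) (l : List ℕ) : ℝ :=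
  if weakLow x l then weakTrans p x y
  else if weakDead x l then 0
  else if weakLow y l then
    (1 + rho p x * Dfin p x l.headI) / (1 + rho p x * Dfin p x (y + 1))
  else 1

open Classical in
/-- Conditional version of `weakLast` given the history. -/
def weakFinal (p : ℕ → ℝ) (y : ℕ) (l : List ℕ) : ℝ :=
  if weakLow y l then weakLast p y
  else if weakDead y l then 0
  else (1 + rho p y * Dfin p y l.headI) / (1 + rho p y * D p y)

theorem weakLow.headI_le {x : ℕ} {l : List ℕ} (h : weakLow x l) : l.headI ≤ x := by
  cases l with
  | nil => exact Nat.zero_le x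
  | cons a l => exact (weakLow_cons.1 h).1

namespace IsTransient

theorem one_add_pos (hp : IsTransient p) (x y : ℕ) : 0 < 1 + rho p x * Dfin p x y := by
  have := mul_nonneg (hp.rho_nonneg x) (hp.Dfin_nonneg x y)
  linarith

theorem one_add_D_pos (hp : IsTransient p) (x : ℕ) : 0 < 1 + rho p x * D p x := by
  have := mul_nonneg (hp.rho_nonneg x) (hp.D_pos x).le
  linarith

theorem weakTrans_pos (hp : IsTransient p) (x y : ℕ) : 0 < weakTrans p x y :=
  div_pos (by linarith [hp.rho_nonneg x]) (hp.one_add_pos _ _)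

theorem weakTrans_le_one (hp : IsTransient p) {x y : ℕ} (h : x ≤ y) : weakTrans p x y ≤ 1 := by
  refine div_le_one_of_le₀ ?_ (hp.one_add_pos _ _).le
  have := mul_le_mul_of_nonneg_left (hp.one_le_Dfin (show x < y + 1 by omega)) (hp.rho_nonneg x)
  linarith

theorem weakLast_pos (hp : IsTransient p) (y : ℕ) : 0 < weakLast p y :=
  div_pos (by linarith [hp.rho_nonneg y]) (hp.one_add_D_pos _)

theorem weakLast_le_one (hp : IsTransient p) (y : ℕ) : weakLast p y ≤ 1 := by
  refine div_le_one_of_le₀ ?_ (hp.one_add_D_pos _).le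
  have := mul_le_mul_of_nonneg_left (hp.one_lt_D y).le (hp.rho_nonneg y)
  linarith

/-- The function `1 + ρ x * Dfin x z` of `z ≥ x`, extended by `0` to `z = x - 1`, is harmonic
at `x`. -/
theorem one_add_harmonic_self (hp : IsTransient p) (x : ℕ) :
    1 + rho p x * Dfin p x x = p x * (1 + rho p x * Dfin p x (x + 1)) := by
  rw [Dfin_self, Dfin_self_succ]
  linear_combination (-1 : ℝ) * hp.mul_one_add_rho x

theorem one_add_harmonic (hp : IsTransient p) {x z : ℕ} (h : x < z) :
    1 + rho p x * Dfin p x z = p z * (1 + rho p x * Dfin p x (z + 1)) +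
      (1 - p z) * (1 + rho p x * Dfin p x (z - 1)) := by
  linear_combination rho p x * hp.Dfin_harmonic h

/-- For x ≥ 1, `1 + ρ x * Dfin x z` is D(x - 1, z), the scale function that vanishes at the
forbidden site x - 1. At x = 0 it is constantly 1, as ρ 0 = 0. After the walk has been above y
without being dead for y, it stays at or above y > x, so nothing more can happen at x. -/
theorem links_weak (hp : IsTransient p) {x y : ℕ} (hxy : x < y) :
    Links p (weakLow x) (weakDead x) (weakLow y) (weakDead y) (weakLink p x y)
      (weakEvent x) (weakEvent y) where
  mono z l _ h := weakLow_mono hxy.le h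
  inv_low z l h hl z' h' := by
    rw [weakLink, weakLink, if_pos hl]
    by_cases hz : z' ≤ x
    · rw [if_pos (weakLow_cons.2 ⟨hz, hl⟩)]
    · obtain rfl : z' = x + 1 := by
        have := h'.1
        have := (weakLow_cons.1 hl).1
        omega
      have hd : ¬ weakDead x ((x + 1) :: z :: l) := by
        rintro (hd | hd)
        · exact hd.not_low hl
        · omega
      rw [if_neg fun hc => hz (weakLow_cons.1 hc).1, if_neg hd,
        if_pos (weakLow_cons.2 ⟨hxy, weakLow_mono hxy.le hl⟩), List.headI_cons, Dfin_self_succ,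
        mul_one, weakTrans]
  harmonic z l h hl hl' _ := by
    have hlow : ∀ z', ¬ weakLow x (z' :: z :: l) := fun z' hc => hl (weakLow_cons.1 hc).2
    by_cases hd : weakDead x (z :: l)
    · have hd' : ∀ z', weakDead x (z' :: z :: l) := fun z' => Or.inl hd
      simp [weakLink, hl, hlow, hd, hd']
    · have hxz := le_of_not_weakDead hl hd
      have hzy := (weakLow_cons.1 hl').1
      have hne := (hp.one_add_pos x (y + 1)).ne'
      have h0 : weakLink p x y (z :: l) =
          (1 + rho p x * Dfin p x z) / (1 + rho p x * Dfin p x (y + 1)) := by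
        rw [weakLink, if_neg hl, if_neg hd, if_pos hl', List.headI_cons]
      have h1 : weakLink p x y ((z + 1) :: z :: l) =
          (1 + rho p x * Dfin p x (z + 1)) / (1 + rho p x * Dfin p x (y + 1)) := by
        have hd1 : ¬ weakDead x ((z + 1) :: z :: l) := by
          rintro (hd1 | hd1)
          · exact hd hd1
          · omega
        rw [weakLink, if_neg (hlow _), if_neg hd1, List.headI_cons]
        by_cases hzy' : z = y
        · subst hzy'
          rw [if_neg fun hc => absurd (weakLow_cons.1 hc).1 (by omega), div_self hne]
        · rw [if_pos (weakLow_cons.2 ⟨by omega, hl'⟩)]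
      rw [h0, h1]
      rcases hxz.eq_or_lt with rfl | hxz
      · have h2 : (1 - p x) * weakLink p x y ((x - 1) :: x :: l) = 0 := by
          rcases Nat.eq_zero_or_pos x with hx | hx
          · simp [hx, hp.zero]
          · rw [weakLink, if_neg (hlow _), if_pos (weakDead_cons.2 (Or.inr ⟨by omega, hl⟩)),
              mul_zero]
        rw [h2, hp.one_add_harmonic_self]
        ring
      · have h2 : weakLink p x y ((z - 1) :: z :: l) =
            (1 + rho p x * Dfin p x (z - 1)) / (1 + rho p x * Dfin p x (y + 1)) := by
          have hd1 : ¬ weakDead x ((z - 1) :: z :: l) := by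
            rintro (hd1 | hd1)
            · exact hd hd1
            · omega
          rw [weakLink, if_neg (hlow _), if_neg hd1, List.headI_cons,
            if_pos (weakLow_cons.2 ⟨by omega, hl'⟩)]
        rw [h2, hp.one_add_harmonic hxz]
        ring
  inv_high z l h hl z' h' hd := by
    have hl' : ¬ weakLow y (z' :: z :: l) := fun hc => hl (weakLow_cons.1 hc).2
    have hlx : ¬ weakLow x (z :: l) := fun hc => hl (weakLow_mono hxy.le hc)
    have hlx' : ¬ weakLow x (z' :: z :: l) := fun hc => hl' (weakLow_mono hxy.le hc)
    have hiff : weakDead x (z' :: z :: l) ↔ weakDead x (z :: l) := by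
      refine ⟨fun hc => ?_, Or.inl⟩
      rcases hc with hc | hc
      · exact hc
      · exact absurd (Or.inr ⟨by omega, hl⟩) hd
    simp only [weakLink, if_neg hl, if_neg hl', if_neg hlx, if_neg hlx']
    by_cases hdx : weakDead x (z :: l)
    · rw [if_pos hdx, if_pos (hiff.2 hdx)]
    · rw [if_neg hdx, if_neg fun hc => hdx (hiff.1 hc)]
  eq_zero z l h hd := by
    left
    rw [weakLink, if_neg hd.not_low, if_pos hd]
  nonneg l := by
    rw [weakLink]
    split_ifs
    · exact (hp.weakTrans_pos x y).le
    · exact le_rfl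
    · exact (div_pos (hp.one_add_pos _ _) (hp.one_add_pos _ _)).le
    · exact zero_le_one
  le_one l := by
    rw [weakLink]
    split_ifs with h1 h2 h3
    · exact hp.weakTrans_le_one hxy.le
    · exact zero_le_one
    · refine div_le_one_of_le₀ ?_ (hp.one_add_pos _ _).le
      have := mul_le_mul_of_nonneg_left (hp.Dfin_mono x (h3.headI_le.trans (Nat.le_succ y)))
        (hp.rho_nonneg x)
      linarith
    · exact le_rfl
  lim w hw _ := by
    have hlow : ∀ᶠ n in atTop, ¬ weakLow y (hist w n) := by
      filter_upwards [hw.tendsto.eventually_gt_atTop y] with n hn hc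
      exact absurd (weakLow_hist.1 hc n le_rfl) (by omega)
    refine tendsto_const_nhds.congr' ?_
    by_cases hE : w ∈ weakEvent x
    · filter_upwards [hlow] with n hn
      rw [weakLink, if_neg fun hc => hn (weakLow_mono hxy.le hc), if_neg (mem_weakEvent hE n),
        if_neg hn, Set.indicator_of_mem hE]
    · filter_upwards [not_mem_weakEvent hE] with n hd
      rw [weakLink, if_neg hd.not_low, if_pos hd, Set.indicator_of_notMem hE]

theorem solves_weak (hp : IsTransient p) (y : ℕ) :
    Solves p (weakLow y) (weakDead y) (weakFinal p y) (weakEvent y) := by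
  have inv : ∀ z l, IsPath (z :: l) → weakLow y (z :: l) → ∀ z', IsPath (z' :: z :: l) →
      weakFinal p y (z' :: z :: l) = weakFinal p y (z :: l) := by
    intro z l h hl z' h'
    rw [weakFinal, weakFinal, if_pos hl]
    by_cases hz : z' ≤ y
    · rw [if_pos (weakLow_cons.2 ⟨hz, hl⟩)]
    · obtain rfl : z' = y + 1 := by
        have := h'.1
        have := (weakLow_cons.1 hl).1
        omega
      have hd : ¬ weakDead y ((y + 1) :: z :: l) := by
        rintro (hd | hd)
        · exact hd.not_low hl
        · omega
      rw [if_neg fun hc => hz (weakLow_cons.1 hc).1, if_neg hd, List.headI_cons, Dfin_self_succ,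
        mul_one, weakLast]
  refine
    { inv := inv
      harmonic := ?_
      eq_zero := ?_
      nonneg := ?_
      le_one := ?_
      lim := ?_ }
  · intro z l h
    by_cases hl : weakLow y (z :: l)
    · rw [← one_mul (weakFinal p y (z :: l))]
      refine harmonic_congr hp.zero h (Ψ := fun _ => weakFinal p y (z :: l)) (fun z' h' => ?_)
        (by ring)
      rw [inv z l h hl z' h', one_mul]
    · have hlow : ∀ z', ¬ weakLow y (z' :: z :: l) := fun z' hc => hl (weakLow_cons.1 hc).2
      by_cases hd : weakDead y (z :: l)
      · have hd' : ∀ z', weakDead y (z' :: z :: l) := fun z' => Or.inl hd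
        simp [weakFinal, hl, hlow, hd, hd']
      · have hyz := le_of_not_weakDead hl hd
        have hval : ∀ z', y ≤ z' → weakFinal p y (z' :: z :: l) =
            (1 + rho p y * Dfin p y z') / (1 + rho p y * D p y) := by
          intro z' hz'
          have hd1 : ¬ weakDead y (z' :: z :: l) := by
            rintro (hd1 | hd1)
            · exact hd hd1
            · omega
          rw [weakFinal, if_neg (hlow _), if_neg hd1, List.headI_cons]
        have h0 : weakFinal p y (z :: l) =
            (1 + rho p y * Dfin p y z) / (1 + rho p y * D p y) := by
          rw [weakFinal, if_neg hl, if_neg hd, List.headI_cons]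
        rw [h0, hval (z + 1) (by omega)]
        rcases hyz.eq_or_lt with rfl | hyz
        · have h2 : (1 - p y) * weakFinal p y ((y - 1) :: y :: l) = 0 := by
            rcases Nat.eq_zero_or_pos y with hy | hy
            · simp [hy, hp.zero]
            · rw [weakFinal, if_neg (hlow _), if_pos (weakDead_cons.2 (Or.inr ⟨by omega, hl⟩)),
              mul_zero]
          rw [h2, hp.one_add_harmonic_self]
          ring
        · rw [hval (z - 1) (by omega), hp.one_add_harmonic hyz]
          ring
  · intro z l h hd
    rw [weakFinal, if_neg hd.not_low, if_pos hd]
  · intro l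
    rw [weakFinal]
    split_ifs
    · exact (hp.weakLast_pos y).le
    · exact le_rfl
    · exact (div_pos (hp.one_add_pos _ _) (hp.one_add_D_pos _)).le
  · intro l
    rw [weakFinal]
    split_ifs
    · exact hp.weakLast_le_one y
    · exact zero_le_one
    · refine div_le_one_of_le₀ ?_ (hp.one_add_D_pos _).le
      have := mul_le_mul_of_nonneg_left (hp.Dfin_le_D y l.headI) (hp.rho_nonneg y)
      linarith
  · intro w hw
    by_cases hE : w ∈ weakEvent y
    · rw [Set.indicator_of_mem hE]
      have h1 : Tendsto (fun n => (1 + rho p y * Dfin p y (w n)) / (1 + rho p y * D p y)) atTop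
          (𝓝 1) := by
        have := ((((hp.tendsto_Dfin y).comp hw.tendsto).const_mul (rho p y)).const_add
          1).div_const (1 + rho p y * D p y)
        rwa [div_self (hp.one_add_D_pos y).ne'] at this
      refine h1.congr' ?_
      filter_upwards [hw.tendsto.eventually_gt_atTop y] with n hn
      have hlow : ¬ weakLow y (hist w n) := fun hc =>
        absurd (weakLow_hist.1 hc n le_rfl) (by omega)
      rw [weakFinal, if_neg hlow, if_neg (mem_weakEvent hE n), headI_hist]
    · rw [Set.indicator_of_notMem hE]
      refine tendsto_const_nhds.congr' ?_
      filter_upwards [not_mem_weakEvent hE] with n hd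
      rw [weakFinal, if_neg hd.not_low, if_pos hd]

end IsTransient

/-! ### The product formula for the joint law -/

/-- The product is built from the top site downwards, since a link conditions on the upper site. The
extension by one site is an abstract hypothesis because C(a, b) needs two links per site. -/
theorem Solves.chain {low dead : ℕ → List ℕ → Prop} {G : ℕ → ℕ → List ℕ → ℝ}
    {Ψ : ℕ → List ℕ → ℝ} {E : ℕ → Set (ℕ → ℕ)}
    (hΨ : ∀ y, Solves p (low y) (dead y) (Ψ y) (E y))
    (hG : ∀ x y Φ F, x < y → F ⊆ E y → Solves p (low y) (dead y) Φ F →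
      Solves p (low x) (dead x) (fun l => G x y l * Φ l) (E x ∩ F))
    {k : ℕ} (hk : 1 ≤ k) {j : ℕ → ℕ} (hj : ∀ i ∈ Finset.Ico 1 k, j i < j (i + 1)) :
    Solves p (low (j 1)) (dead (j 1))
      (fun l => (∏ i ∈ Finset.Ico 1 k, G (j i) (j (i + 1)) l) * Ψ (j k) l)
      {w | ∀ i ∈ Finset.Icc 1 k, w ∈ E (j i)} := by
  suffices h : ∀ m, m ≤ k → 1 ≤ m → Solves p (low (j m)) (dead (j m))
      (fun l => (∏ i ∈ Finset.Ico m k, G (j i) (j (i + 1)) l) * Ψ (j k) l)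
      {w | ∀ i ∈ Finset.Icc m k, w ∈ E (j i)} from h 1 hk le_rfl
  intro m hm
  induction hm using Nat.decreasingInduction with
  | self =>
    intro _
    have h := hΨ (j k)
    have e : {w | ∀ i ∈ Finset.Icc k k, w ∈ E (j i)} = E (j k) := by
      ext w; simp
    rw [e]
    simpa using h
  | of_succ m hm ih =>
    intro h1
    have h := hG (j m) (j (m + 1)) _
      {w | ∀ i ∈ Finset.Icc (m + 1) k, w ∈ E (j i)} (hj m (Finset.mem_Ico.2 ⟨h1, hm⟩))
      (fun w hw => hw (m + 1) (Finset.mem_Icc.2 ⟨le_rfl, hm⟩)) (ih (by omega))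
    have e : E (j m) ∩ {w | ∀ i ∈ Finset.Icc (m + 1) k, w ∈ E (j i)} =
        {w | ∀ i ∈ Finset.Icc m k, w ∈ E (j i)} := by
      ext w
      simp only [Set.mem_inter_iff, Set.mem_ofPred_eq, Finset.mem_Icc]
      refine ⟨fun hw i hi => ?_, fun hw => ⟨hw m ⟨le_rfl, hm.le⟩,
        fun i hi => hw i ⟨by omega, hi.2⟩⟩⟩
      rcases hi.1.eq_or_lt with rfl | h'
      · exact hw.1
      · exact hw.2 i ⟨h', hi.2⟩
    rw [e] at h
    have e' : (fun l => (∏ i ∈ Finset.Ico m k, G (j i) (j (i + 1)) l) * Ψ (j k) l) =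
        fun l => G (j m) (j (m + 1)) l *
          ((∏ i ∈ Finset.Ico (m + 1) k, G (j i) (j (i + 1)) l) * Ψ (j k) l) := by
      funext l
      rw [Finset.prod_eq_prod_Ico_succ_bot hm, mul_assoc]
    rw [e']
    exact h

/-- `upLink`, extended to two prescriptions at the same site. -/
def upLink' (p : ℕ → ℝ) (x t y u : ℕ) (l : List ℕ) : ℝ :=
  if x = y then if t = u then 1 else 0 else upLink p x t y u l

theorem IsTransient.links_up' (hp : IsTransient p) {x y : ℕ} (hxy : x ≤ y) (t u : ℕ) :
    Links p (upLow x) (upDead x t) (upLow y) (upDead y u) (upLink' p x t y u)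
      (upEvent x t) (upEvent y u) := by
  rcases hxy.eq_or_lt with rfl | h
  · have := links_up_self (p := p) x t u
    unfold upLink'
    simpa using this
  · have e : upLink' p x t y u = upLink p x t y u := by
      funext l
      rw [upLink', if_neg h.ne]
    rw [e]
    exact hp.links_up h t u

theorem upLink'_start (x t y u : ℕ) : upLink' p x t y u [0] = upTrans p x t y u := by
  simp [upLink', upTrans, upLink, upLinkAux, downCount]

theorem upFinal_start (y u : ℕ) : upFinal p y u [0] = upLast p y u := by
  simp [upFinal, upFinalAux, downCount]

theorem weakLink_start (x y : ℕ) : weakLink p x y [0] = weakTrans p x y := by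
  rw [weakLink, if_pos (by simp [weakLow])]

theorem weakFinal_start (y : ℕ) : weakFinal p y [0] = weakLast p y := by
  rw [weakFinal, if_pos (by simp [weakLow])]

namespace CutClass

/-- Probability of `x ∈ C` given `y ∈ C`, for `x < y`. -/
def pairWeight (p : ℕ → ℝ) : CutClass → ℕ → ℕ → ℝ
  | weak, x, y => weakTrans p x y
  | both a b, x, y => upTrans p (x - 1) (preTarget a b x) x b *
      upTrans p x b (y - 1) (preTarget a b y)
  | up a, x, y => upTrans p x a y a

/-- Probability of `y ∈ C`. -/
def lastWeight (p : ℕ → ℝ) : CutClass → ℕ → ℝ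
  | weak, y => weakLast p y
  | both a b, y => upTrans p (y - 1) (preTarget a b y) y b * upLast p y b
  | up a, y => upLast p y a

/-- The joint law of the events `j ∈ C` has a product form. -/
theorem real_forall_event {Ω : Type*} [MeasurableSpace Ω] {P : Measure Ω} [IsProbabilityMeasure P]
    {X : ℕ → Ω → ℕ} (hp : IsTransient p) (hX : IsWalk P p X) {C : CutClass} (hC : C.Valid)
    {k : ℕ} (hk : 1 ≤ k) {j : ℕ → ℕ} (hj : ∀ i ∈ Finset.Ico 1 k, j i < j (i + 1)) :
    NullMeasurableSet {ω | ∀ i ∈ Finset.Icc 1 k, ω ∈ C.event X (j i)} P ∧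
    P.real {ω | ∀ i ∈ Finset.Icc 1 k, ω ∈ C.event X (j i)} =
      (∏ i ∈ Finset.Ico 1 k, C.pairWeight p (j i) (j (i + 1))) * C.lastWeight p (j k) := by
  cases C with
  | weak =>
    have h := Solves.chain hp.solves_weak
      (fun x y Φ F hxy hF hΦ => hΦ.mul hp.zero (hp.links_weak hxy) hF) hk hj
    have h' := (h.congr (F := {w | ∀ i ∈ Finset.Icc 1 k, j i ∈ weak.sites w})
      fun w hw => forall₂_congr fun i _ => (hw.mem_sites_weak (j i)).symm).real_eq hp hX
    simp only [weakLink_start, weakFinal_start] at h'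
    exact h'
  | up a =>
    have h := Solves.chain (fun y => hp.solves_up y a)
      (fun x y Φ F hxy hF hΦ => hΦ.mul hp.zero (hp.links_up' hxy.le a a) hF) hk hj
    have h' := (h.congr (F := {w | ∀ i ∈ Finset.Icc 1 k, j i ∈ (up a).sites w})
      fun w hw => forall₂_congr fun i _ => (hw.mem_sites_up a (j i)).symm).real_eq hp hX
    simp only [upLink'_start, upFinal_start] at h'
    exact h'
  | both a b =>
    have h := Solves.chain (p := p) (low := fun x => upLow (x - 1))
      (dead := fun x => upDead (x - 1) (preTarget a b x))
      (G := fun x y l => upLink' p (x - 1) (preTarget a b x) x b l *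
        upLink' p x b (y - 1) (preTarget a b y) l)
      (Ψ := fun y l => upLink' p (y - 1) (preTarget a b y) y b l * upFinal p y b l)
      (E := fun x => upEvent (x - 1) (preTarget a b x) ∩ upEvent x b)
      (fun y => (hp.solves_up y b).mul hp.zero (hp.links_up' (Nat.sub_le y 1) _ _) subset_rfl)
      (fun x y Φ F hxy hF hΦ => by
        -- The levels x - 1 ≤ x ≤ y - 1 ≤ y carry the prescriptions; equalities occur for x = 0 and
        -- for y = x + 1.
        have h1 := hΦ.mul hp.zero (hp.links_up' (show x ≤ y - 1 by omega) b (preTarget a b y))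
          (hF.trans Set.inter_subset_left)
        have h2 := h1.mul hp.zero (hp.links_up' (Nat.sub_le x 1) (preTarget a b x) b)
          Set.inter_subset_left
        simpa only [mul_assoc, Set.inter_assoc] using h2) hk hj
    have h' := (h.congr (F := {w | ∀ i ∈ Finset.Icc 1 k, j i ∈ (both a b).sites w})
      fun w hw => forall₂_congr fun i _ => (hw.mem_sites_both hC.2 (j i)).symm).real_eq hp hX
    simp only [upLink'_start, upFinal_start] at h'
    exact h'

end CutClass

/-! ### Growth of the scale function when ρ → 1 -/

theorem tendsto_fst_atTop : Tendsto (Prod.fst : ℕ × ℕ → ℕ) atTop atTop := by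
  rw [← prod_atTop_atTop_eq]; exact tendsto_fst

theorem tendsto_snd_atTop : Tendsto (Prod.snd : ℕ × ℕ → ℕ) atTop atTop := by
  rw [← prod_atTop_atTop_eq]; exact tendsto_snd

theorem eventually_atTop_of_add {Q : ℕ → ℕ → Prop} {N J : ℕ}
    (h : ∀ x ≥ N, ∀ y ≥ x + J, Q x y) : ∀ᶠ q : ℕ × ℕ in atTop, Q q.1 (q.1 + q.2) := by
  filter_upwards [tendsto_fst_atTop.eventually_ge_atTop N,
    tendsto_snd_atTop.eventually_ge_atTop J] with q h1 h2
  exact h _ h1 _ (by omega)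

/-- Limits along pairs (x, y - x) in `atTop` express uniformity over x > N and y > x + N. -/
theorem exists_forall_of_eventually {Q : ℕ → ℕ → Prop}
    (h : ∀ᶠ q : ℕ × ℕ in atTop, Q q.1 (q.1 + q.2)) :
    ∃ N : ℕ, ∀ x y, N < x → x + N < y → Q x y := by
  obtain ⟨⟨a, b⟩, hab⟩ := eventually_atTop.1 h
  refine ⟨max a b, fun x y hx hy => ?_⟩
  have := hab (x, y - x) ⟨by simp; omega, by simp; omega⟩
  simp only at this
  rwa [show x + (y - x) = y by omega] at this

/-- A sequence with a positive lower bound far out has a positive lower bound for its nonzero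
terms. -/
theorem exists_pos_le_of_eventually {f : ℕ → ℝ} (hf : ∀ x, 0 ≤ f x) {c : ℝ} (hc : 0 < c)
    (h : ∀ᶠ x in atTop, c ≤ f x) : ∃ c' > 0, ∀ x, f x = 0 ∨ c' ≤ f x := by
  obtain ⟨N, hN⟩ := eventually_atTop.1 h
  have key : ∀ n, ∃ c' > 0, ∀ x < n, f x = 0 ∨ c' ≤ f x := by
    intro n
    induction n with
    | zero => exact ⟨1, one_pos, fun x hx => absurd hx (Nat.not_lt_zero x)⟩
    | succ n ih =>
      obtain ⟨c', hc', h'⟩ := ih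
      rcases (hf n).eq_or_lt with h0 | h0
      · refine ⟨c', hc', fun x hx => ?_⟩
        rcases (Nat.lt_succ_iff.1 hx).eq_or_lt with rfl | hx
        · exact Or.inl h0.symm
        · exact h' x hx
      · refine ⟨min c' (f n), lt_min hc' h0, fun x hx => ?_⟩
        rcases (Nat.lt_succ_iff.1 hx).eq_or_lt with rfl | hx
        · exact Or.inr (min_le_right _ _)
        · exact (h' x hx).imp_right (min_le_left _ _).trans
  obtain ⟨c', hc', h'⟩ := key N
  refine ⟨min c c', lt_min hc hc', fun x => ?_⟩
  rcases Nat.lt_or_ge x N with hx | hx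
  · exact (h' x hx).imp_right (min_le_right _ _).trans
  · exact Or.inr ((min_le_left _ _).trans (hN x hx))

namespace IsTransient

theorem exists_le_rho (hp : IsTransient p) (hrho : Tendsto (rho p) atTop (𝓝 1)) :
    ∃ m > 0, ∀ k, 1 ≤ k → m ≤ rho p k := by
  obtain ⟨m, hm, h⟩ := exists_pos_le_of_eventually hp.rho_nonneg (c := 1 / 2) (by norm_num)
    (hrho.eventually_const_le (by norm_num))
  exact ⟨m, hm, fun k hk => (h k).resolve_left (hp.rho_pos hk).ne'⟩

theorem exists_rho_le (hp : IsTransient p) (hrho : Tendsto (rho p) atTop (𝓝 1)) :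
    ∃ M ≥ 0, ∀ k, rho p k ≤ M := by
  obtain ⟨M, hM⟩ := hrho.bddAbove_range
  have h : ∀ k, rho p k ≤ M := fun k => hM ⟨k, rfl⟩
  exact ⟨M, (hp.rho_nonneg 0).trans (h 0), h⟩

theorem Dfin_succ_le (hp : IsTransient p) {M : ℝ} (hM : ∀ k, rho p k ≤ M) {x y : ℕ} (h : x < y) :
    Dfin p x (y + 1) ≤ (1 + M) * Dfin p x y := by
  obtain ⟨y, rfl⟩ : ∃ z, y = z + 1 := ⟨y - 1, by omega⟩
  rw [Dfin_succ (show x ≤ y + 1 by omega), rhoProd_succ (by omega)]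
  have h1 : rhoProd p x y ≤ Dfin p x (y + 1) := by
    rw [Dfin_succ (by omega)]
    linarith [hp.Dfin_nonneg x y]
  have h2 := mul_le_mul h1 (hM (y + 1)) (hp.rho_nonneg _) (hp.Dfin_nonneg x (y + 1))
  linarith

theorem one_add_le_Dfin (hp : IsTransient p) {m : ℝ} (hm : ∀ k, 1 ≤ k → m ≤ rho p k) {x y : ℕ}
    (h : x + 2 ≤ y) : 1 + m ≤ Dfin p x y := by
  refine le_trans ?_ (hp.Dfin_mono x h)
  rw [Dfin_succ (by omega), Dfin_self_succ, rhoProd_succ le_rfl, rhoProd_self, one_mul]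
  linarith [hm (x + 1) (by omega)]

/-- The first J terms of D(x, y) are products of at most J factors close to 1. The induction peels
off the first factor. -/
theorem exists_le_Dfin (hp : IsTransient p) (hrho : Tendsto (rho p) atTop (𝓝 1)) (J : ℕ) :
    ∀ c < (J : ℝ), ∃ N, ∀ x ≥ N, ∀ y ≥ x + J, c ≤ Dfin p x y := by
  induction J with
  | zero =>
    intro c hc
    exact ⟨0, fun x _ y _ => le_trans (by simpa using hc.le) (hp.Dfin_nonneg x y)⟩
  | succ J ih =>
    intro c hc
    push_cast at hc
    obtain ⟨c', h1, h2⟩ := exists_between (show c - 1 < J by linarith)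
    obtain ⟨N, hN⟩ := ih c' h2
    have h3 : Tendsto (fun k => rho p k * c') atTop (𝓝 (1 * c')) := hrho.mul_const c'
    rw [one_mul] at h3
    obtain ⟨N', hN'⟩ := eventually_atTop.1 (h3.eventually_const_le h1)
    refine ⟨max N N', fun x hx y hy => ?_⟩
    rw [Dfin_eq_one_add (by omega)]
    have h4 := hN (x + 1) (by omega) y (by omega)
    have h5 := hN' (x + 1) (by omega)
    have h6 := mul_le_mul_of_nonneg_left h4 (hp.rho_nonneg (x + 1))
    linarith

/-- The mirror image at the upper end: the last J terms of D(x, y) are all comparable to `rhoProd p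
x y`. This is what makes `alphaDown` tend to 0. -/
theorem exists_mul_rhoProd_le (hp : IsTransient p) (hrho : Tendsto (rho p) atTop (𝓝 1)) (J : ℕ) :
    ∀ c < (J : ℝ), ∃ N, ∀ x ≥ N, ∀ y ≥ x + J, c * rhoProd p x y ≤ Dfin p x y := by
  induction J with
  | zero =>
    intro c hc
    refine ⟨0, fun x _ y _ => le_trans ?_ (hp.Dfin_nonneg x y)⟩
    exact mul_nonpos_of_nonpos_of_nonneg (by simpa using hc.le) (hp.rhoProd_pos x y).le
  | succ J ih =>
    intro c hc
    push_cast at hc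
    obtain ⟨c', h1, h2⟩ := exists_between (show c - 1 < J by linarith)
    obtain ⟨N, hN⟩ := ih c' h2
    have h3 : Tendsto (fun k => c * rho p k) atTop (𝓝 (c * 1)) := hrho.const_mul c
    rw [mul_one] at h3
    obtain ⟨N', hN'⟩ := eventually_atTop.1 (h3.eventually_le_const (show c < c' + 1 by linarith))
    refine ⟨max N N', fun x hx y hy => ?_⟩
    obtain ⟨y, rfl⟩ : ∃ z, y = z + 1 := ⟨y - 1, by omega⟩
    rw [Dfin_succ (by omega), rhoProd_succ (by omega)]
    have h4 := hN x (by omega) y (by omega)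
    have h5 := hN' (y + 1) (by omega)
    have h6 := mul_le_mul_of_nonneg_left h5 (hp.rhoProd_pos x y).le
    linarith

theorem tendsto_Dfin_atTop (hp : IsTransient p) (hrho : Tendsto (rho p) atTop (𝓝 1)) :
    Tendsto (fun q : ℕ × ℕ => Dfin p q.1 (q.1 + q.2)) atTop atTop := by
  rw [tendsto_atTop]
  intro c
  obtain ⟨J, hJ⟩ := exists_nat_gt c
  obtain ⟨N, hN⟩ := hp.exists_le_Dfin hrho J c hJ
  exact eventually_atTop_of_add (Q := fun x y => c ≤ Dfin p x y) hN

theorem tendsto_D_atTop (hp : IsTransient p) (hrho : Tendsto (rho p) atTop (𝓝 1)) :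
    Tendsto (D p) atTop atTop := by
  rw [tendsto_atTop]
  intro c
  obtain ⟨J, hJ⟩ := exists_nat_gt c
  obtain ⟨N, hN⟩ := hp.exists_le_Dfin hrho J c hJ
  filter_upwards [eventually_ge_atTop N] with x hx
  exact (hN x hx _ le_rfl).trans (hp.Dfin_le_D x (x + J))

theorem tendsto_betaUp (hp : IsTransient p) (hrho : Tendsto (rho p) atTop (𝓝 1)) :
    Tendsto (fun q : ℕ × ℕ => betaUp p q.1 (q.1 + q.2)) atTop (𝓝 0) := by
  refine squeeze_zero' (Eventually.of_forall fun q => (hp.betaUp_pos _ _ (by omega)).le) ?_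
    (hp.tendsto_Dfin_atTop hrho).inv_tendsto_atTop
  filter_upwards [tendsto_snd_atTop.eventually_ge_atTop 1] with q hq
  rw [betaUp, one_div]
  exact inv_anti₀ (hp.Dfin_pos (by omega)) (hp.Dfin_mono _ (by omega))

theorem alphaDown_eq (hp : IsTransient p) {x y : ℕ} (h : x ≤ y) :
    alphaDown p x y = rhoProd p x y / Dfin p x (y + 1) := by
  have := (hp.Dfin_pos (show x < y + 1 by omega)).ne'
  rw [alphaDown]
  field_simp
  rw [Dfin_succ h]
  ring

theorem tendsto_alphaDown (hp : IsTransient p) (hrho : Tendsto (rho p) atTop (𝓝 1)) :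
    Tendsto (fun q : ℕ × ℕ => alphaDown p q.1 (q.1 + q.2)) atTop (𝓝 0) := by
  have h1 : Tendsto (fun q : ℕ × ℕ => Dfin p q.1 (q.1 + q.2) / rhoProd p q.1 (q.1 + q.2)) atTop
      atTop := by
    rw [tendsto_atTop]
    intro c
    obtain ⟨J, hJ⟩ := exists_nat_gt c
    obtain ⟨N, hN⟩ := hp.exists_mul_rhoProd_le hrho J c hJ
    filter_upwards [eventually_atTop_of_add (Q := fun x y => c * rhoProd p x y ≤ Dfin p x y) hN]
      with q hq
    rwa [le_div_iff₀ (hp.rhoProd_pos _ _)]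
  refine squeeze_zero' (Eventually.of_forall fun q => hp.alphaDown_nonneg _ _) ?_
    h1.inv_tendsto_atTop
  filter_upwards [tendsto_snd_atTop.eventually_ge_atTop 1] with q hq
  rw [hp.alphaDown_eq (by omega), Pi.inv_apply, inv_div]
  exact div_le_div_of_nonneg_left (hp.rhoProd_pos _ _).le (hp.Dfin_pos (by omega))
    (hp.Dfin_mono _ (by omega))

end IsTransient

/-! ### Limits and bounds of the crossing weights -/

section WeightLimits

variable {ι : Type*} {l : Filter ι} {α β : ι → ℝ} {α₀ β₀ : ℝ} {f : ι → ℕ → ℝ} {g : ℕ → ℝ}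

theorem tendsto_belowWeight (hβ : Tendsto β l (𝓝 β₀))
    (hf : ∀ a, Tendsto (fun i => f i a) l (𝓝 (g a))) (a : ℕ) :
    Tendsto (fun i => belowWeight (β i) (f i) a) l (𝓝 (belowWeight β₀ g a)) := by
  induction a with
  | zero => exact tendsto_const_nhds
  | succ a ih => exact (hβ.mul (hf _)).add ((hβ.const_sub 1).mul ih)

theorem tendsto_aboveWeight (hα : Tendsto α l (𝓝 α₀)) (hβ : Tendsto β l (𝓝 β₀)) (b a : ℕ) :
    Tendsto (fun i => aboveWeight (α i) (β i) b a) l (𝓝 (aboveWeight α₀ β₀ b a)) := by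
  induction b generalizing a with
  | zero => exact tendsto_const_nhds
  | succ b ih =>
    exact ((hα.const_sub 1).mul (ih a)).add (hα.mul (tendsto_belowWeight hβ ih _))

/-- To first order in β exactly one attempt to climb succeeds, and it may be any of the a attempts.
-/
theorem tendsto_belowWeight_div (hβ : Tendsto β l (𝓝 0)) (hβ' : ∀ᶠ i in l, β i ≠ 0)
    (hf : ∀ a, Tendsto (fun i => f i a) l (𝓝 (g a))) (a : ℕ) :
    Tendsto (fun i => belowWeight (β i) (f i) a / β i) l (𝓝 (∑ k ∈ Finset.range a, g (k + 1))) := by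
  induction a with
  | zero => simpa [belowWeight] using tendsto_const_nhds
  | succ a ih =>
    rw [Finset.sum_range_succ, add_comm (∑ k ∈ _, _)]
    have h := (hf (a + 1)).add ((hβ.const_sub 1).mul ih)
    rw [sub_zero, one_mul] at h
    refine h.congr' ?_
    filter_upwards [hβ'] with i hi
    rw [belowWeight]
    field_simp

end WeightLimits

theorem aboveWeight_zero_zero (b a : ℕ) : aboveWeight 0 0 b a = if a = 1 then 1 else 0 := by
  induction b with
  | zero => rfl
  | succ b ih => simp [aboveWeight, ih]

/-- With fair coins the weights are negative binomial and the recursions are Pascal's rule. For b =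
0 the truncated `b + a - 1` gives 1 at a = 0 and 0 for a ≥ 1, as required. -/
theorem weight_half (b : ℕ) :
    (∀ a, aboveWeight (1 / 2) (1 / 2) b (a + 1) = ((b + a - 1).choose a : ℝ) / 2 ^ (b + a)) ∧
    ∀ a, belowWeight (1 / 2) (aboveWeight (1 / 2) (1 / 2) b) (a + 1) =
      ((b + a).choose a : ℝ) / 2 ^ (b + a + 1) := by
  have step : ∀ b, (∀ a, aboveWeight (1 / 2) (1 / 2) b (a + 1) =
      ((b + a - 1).choose a : ℝ) / 2 ^ (b + a)) →
      ∀ a, belowWeight (1 / 2) (aboveWeight (1 / 2) (1 / 2) b) (a + 1) =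
        ((b + a).choose a : ℝ) / 2 ^ (b + a + 1) := by
    intro b h a
    induction a with
    | zero =>
      rw [belowWeight, h, belowWeight]
      simp [pow_succ]
    | succ a ih =>
      rw [belowWeight, ih, h, show b + (a + 1) - 1 = b + a by omega,
        show b + (a + 1) = b + a + 1 by omega, Nat.choose_succ_succ]
      push_cast
      rw [pow_succ _ (b + a + 1)]
      ring
  have above : ∀ a, aboveWeight (1 / 2) (1 / 2) b (a + 1) =
      ((b + a - 1).choose a : ℝ) / 2 ^ (b + a) := by
    induction b with
    | zero =>
      intro a
      cases a with
      | zero => simp [aboveWeight]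
      | succ a => simp [aboveWeight]
    | succ b ih =>
      intro a
      cases a with
      | zero =>
        have h1 := ih 0
        simp only [aboveWeight, h1, Nat.add_sub_cancel, belowWeight, Nat.choose_zero_right]
        rw [add_zero, add_zero, pow_succ]
        ring
      | succ a =>
        simp only [aboveWeight, ih, Nat.add_sub_cancel]
        rw [step b ih a, show b + (a + 1) - 1 = b + a by omega,
          show b + 1 + (a + 1) - 1 = b + a + 1 by omega, Nat.choose_succ_succ,
          show b + 1 + (a + 1) = b + a + 1 + 1 by omega, show b + (a + 1) = b + a + 1 by omega]
        push_cast
        rw [pow_succ _ (b + a + 1)]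
        ring
  exact ⟨above, step b above⟩

section WeightBounds

variable {α β : ℝ}

theorem belowWeight_le (hβ : 0 ≤ β) (hβ' : β ≤ 1) {f : ℕ → ℝ} (hf : ∀ a, f a ≤ 1)
    (hf' : ∀ a, 0 ≤ f a) (a : ℕ) : belowWeight β f a ≤ a * β := by
  induction a with
  | zero => simp [belowWeight]
  | succ a ih =>
    rw [belowWeight]
    have h1 := mul_le_mul_of_nonneg_left (hf (a + 1)) hβ
    have h2 := mul_nonneg hβ (belowWeight_nonneg hβ hβ' hf' a)
    push_cast
    linarith

theorem le_belowWeight (hβ : 0 ≤ β) (hβ' : β ≤ 1) {f : ℕ → ℝ} (hf : ∀ a, 0 ≤ f a) (a : ℕ) :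
    β * (1 - β) ^ a * f 1 ≤ belowWeight β f (a + 1) := by
  induction a with
  | zero => simp [belowWeight]
  | succ a ih =>
    rw [belowWeight, pow_succ]
    have h1 := mul_nonneg hβ (hf (a + 1 + 1))
    have h2 := mul_le_mul_of_nonneg_left ih (show 0 ≤ 1 - β by linarith)
    linarith

theorem le_aboveWeight (hα' : α ≤ 1) (b : ℕ) :
    (1 - α) ^ b ≤ aboveWeight α β b 1 := by
  induction b with
  | zero => simp [aboveWeight]
  | succ b ih =>
    simp only [aboveWeight, belowWeight, Nat.sub_self, mul_zero, add_zero]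
    rw [pow_succ, mul_comm]
    exact mul_le_mul_of_nonneg_left ih (by linarith)

end WeightBounds

namespace IsTransient

theorem _root_.CutWalk.upTrans_of_lt {x y : ℕ} (h : x < y) (t u : ℕ) : upTrans p x t y u =
    belowWeight (betaUp p x y) (aboveWeight (alphaDown p x y) (betaUp p x y) (u - 1)) t :=
  if_neg h.ne

theorem upTrans_nonneg (hp : IsTransient p) {x y : ℕ} (h : x ≤ y) (t u : ℕ) :
    0 ≤ upTrans p x t y u := by
  rcases h.eq_or_lt with rfl | h'
  · rw [upTrans, if_pos rfl]
    split_ifs <;> norm_num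
  · have hβ := (hp.betaUp_pos x y h).le
    have hβ' := hp.betaUp_le_one x y h
    rw [upTrans_of_lt h']
    exact belowWeight_nonneg hβ hβ' (aboveWeight_nonneg (hp.alphaDown_nonneg x y)
      (hp.alphaDown_le_one x y) hβ hβ' _) _

theorem upTrans_le_one (hp : IsTransient p) {x y : ℕ} (h : x ≤ y) (t u : ℕ) :
    upTrans p x t y u ≤ 1 := by
  rcases h.eq_or_lt with rfl | h'
  · rw [upTrans, if_pos rfl]
    split_ifs <;> norm_num
  · have hβ := (hp.betaUp_pos x y h).le
    have hβ' := hp.betaUp_le_one x y h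
    rw [upTrans_of_lt h']
    exact belowWeight_le_one hβ hβ' (aboveWeight_le_one (hp.alphaDown_nonneg x y)
      (hp.alphaDown_le_one x y) hβ hβ' _) _

/-- For x < y there are at most t attempts, each succeeding with probability 1 / D(x, y + 1). The
extra 1 covers x = y. -/
theorem upTrans_mul_Dfin_le (hp : IsTransient p) {x y : ℕ} (h : x ≤ y) (t u : ℕ) :
    upTrans p x t y u * Dfin p x (y + 1) ≤ t + 1 := by
  rcases h.eq_or_lt with rfl | h'
  · rw [Dfin_self_succ, mul_one]
    linarith [hp.upTrans_le_one h t u, (Nat.cast_nonneg t : (0 : ℝ) ≤ t)]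
  · have hβ := (hp.betaUp_pos x y h).le
    have hβ' := hp.betaUp_le_one x y h
    have hα := hp.alphaDown_nonneg x y
    have hα' := hp.alphaDown_le_one x y
    have hD := hp.Dfin_pos (show x < y + 1 by omega)
    rw [upTrans_of_lt h']
    have h1 := mul_le_mul_of_nonneg_right (belowWeight_le hβ hβ'
      (aboveWeight_le_one hα hα' hβ hβ' (u - 1)) (aboveWeight_nonneg hα hα' hβ hβ' (u - 1)) t) hD.le
    have h2 : t * betaUp p x y * Dfin p x (y + 1) = t := by
      rw [betaUp]
      field_simp
    linarith

theorem exists_le_upTrans (hp : IsTransient p) (hrho : Tendsto (rho p) atTop (𝓝 1)) {t : ℕ}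
    (ht : 1 ≤ t) (u : ℕ) :
    ∃ c > 0, ∀ x y, x < y → c ≤ upTrans p x t y u * Dfin p x (y + 1) := by
  obtain ⟨m, hm, hm'⟩ := hp.exists_le_rho hrho
  obtain ⟨M, hM, hM'⟩ := hp.exists_rho_le hrho
  have hm1 : 0 < 1 - 1 / (1 + m) := by
    rw [sub_pos, div_lt_one (by linarith)]
    linarith
  -- One favourable scenario: t - 1 failed climbs, a success, and u - 1 later descents through y
  -- none of which reaches x. Here D(x, y + 1) ≥ 1 + m bounds `betaUp` away from 1, and D(x, y + 1)
  -- ≤ (1 + M) D(x, y) does so for `alphaDown`.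
  refine ⟨(1 - 1 / (1 + m)) ^ (t - 1) * (1 / (1 + M)) ^ (u - 1), by positivity, fun x y h => ?_⟩
  have hβ := (hp.betaUp_pos x y h.le).le
  have hβ' := hp.betaUp_le_one x y h.le
  have hα := hp.alphaDown_nonneg x y
  have hα' := hp.alphaDown_le_one x y
  have hD := hp.Dfin_pos (show x < y + 1 by omega)
  have h1 : 1 - 1 / (1 + m) ≤ 1 - betaUp p x y := by
    rw [betaUp]
    have := one_div_le_one_div_of_le (by linarith) (hp.one_add_le_Dfin hm' (show x + 2 ≤ y + 1 by
      omega))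
    linarith
  have h2 : 1 / (1 + M) ≤ 1 - alphaDown p x y := by
    rw [alphaDown, sub_sub_cancel, div_le_div_iff₀ (by linarith) hD]
    have := hp.Dfin_succ_le hM' h
    linarith
  have h3 := (pow_le_pow_left₀ (by positivity) h2 (u - 1)).trans
    (le_aboveWeight (β := betaUp p x y) hα' (u - 1))
  have h4 := le_belowWeight hβ hβ' (aboveWeight_nonneg hα hα' hβ hβ' (u - 1)) (t - 1)
  rw [Nat.sub_add_cancel ht] at h4
  have h5 := mul_le_mul_of_nonneg_right h4 hD.le
  rw [upTrans_of_lt h]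
  refine le_trans ?_ h5
  have h6 : betaUp p x y * (1 - betaUp p x y) ^ (t - 1) *
      aboveWeight (alphaDown p x y) (betaUp p x y) (u - 1) 1 * Dfin p x (y + 1) =
      (1 - betaUp p x y) ^ (t - 1) *
        aboveWeight (alphaDown p x y) (betaUp p x y) (u - 1) 1 := by
    have : betaUp p x y * Dfin p x (y + 1) = 1 := by
      rw [betaUp]
      field_simp
    linear_combination ((1 - betaUp p x y) ^ (t - 1) *
      aboveWeight (alphaDown p x y) (betaUp p x y) (u - 1) 1) * this
  rw [h6]
  exact mul_le_mul (pow_le_pow_left₀ hm1.le h1 _) h3 (by positivity)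
    (pow_nonneg (by linarith) _)

theorem tendsto_upTrans (hp : IsTransient p) (hrho : Tendsto (rho p) atTop (𝓝 1)) {t : ℕ}
    (ht : 1 ≤ t) (u : ℕ) :
    Tendsto (fun q : ℕ × ℕ => upTrans p q.1 t (q.1 + q.2) u * Dfin p q.1 (q.1 + q.2 + 1)) atTop
      (𝓝 1) := by
  have hβ := hp.tendsto_betaUp hrho
  have hα := hp.tendsto_alphaDown hrho
  have hlim := tendsto_belowWeight_div hβ
    (Eventually.of_forall fun q => (hp.betaUp_pos _ _ (by omega)).ne')
    (fun a => tendsto_aboveWeight hα hβ (u - 1) a) t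
  -- In the limit descents through y never reach x, so all t crossings must be made before the first
  -- passage above y.
  have hval : ∑ k ∈ Finset.range t, aboveWeight 0 0 (u - 1) (k + 1) = 1 := by
    simp only [aboveWeight_zero_zero]
    rw [Finset.sum_eq_single_of_mem 0 (Finset.mem_range.2 ht) (fun k _ hk => if_neg (by omega))]
    simp
  rw [hval] at hlim
  refine hlim.congr' ?_
  filter_upwards [tendsto_snd_atTop.eventually_ge_atTop 1] with q hq
  rw [upTrans_of_lt (by omega), betaUp, div_div_eq_mul_div, div_one]

theorem _root_.CutWalk.tendsto_upTrans_pred (hrho : Tendsto (rho p) atTop (𝓝 1)) {t b : ℕ}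
    (ht : 1 ≤ t) : Tendsto (fun x => upTrans p (x - 1) t x b) atTop
      (𝓝 (((b - 1 + (t - 1)).choose (t - 1) : ℝ) / 2 ^ (b - 1 + (t - 1) + 1))) := by
  have hD : ∀ x, 1 ≤ x → Dfin p (x - 1) x = 1 ∧ Dfin p (x - 1) (x + 1) = 1 + rho p x := by
    intro x hx
    obtain ⟨x, rfl⟩ : ∃ z, x = z + 1 := ⟨x - 1, by omega⟩
    rw [Nat.add_sub_cancel, Dfin_succ (show x ≤ x + 1 by omega), rhoProd_succ le_rfl]
    simp
  have h0 : Tendsto (fun x => 1 / (1 + rho p x)) atTop (𝓝 (1 / 2)) := by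
    have := (tendsto_const_nhds (x := (1 : ℝ))).div (hrho.const_add 1) (by norm_num)
    rwa [show (1 : ℝ) + 1 = 2 by norm_num] at this
  have hβ : Tendsto (fun x => betaUp p (x - 1) x) atTop (𝓝 (1 / 2)) := by
    refine h0.congr' ?_
    filter_upwards [eventually_ge_atTop 1] with x hx
    rw [betaUp, (hD x hx).2]
  have hα : Tendsto (fun x => alphaDown p (x - 1) x) atTop (𝓝 (1 / 2)) := by
    have h1 := h0.const_sub 1
    rw [show (1 : ℝ) - 1 / 2 = 1 / 2 by norm_num] at h1
    refine h1.congr' ?_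
    filter_upwards [eventually_ge_atTop 1] with x hx
    rw [alphaDown, (hD x hx).1, (hD x hx).2]
  have hlim := tendsto_belowWeight hβ (fun a => tendsto_aboveWeight hα hβ (b - 1) a) t
  obtain ⟨s, rfl⟩ : ∃ s, t = s + 1 := ⟨t - 1, by omega⟩
  rw [(weight_half (b - 1)).2 s] at hlim
  refine hlim.congr' ?_
  filter_upwards [eventually_ge_atTop 1] with x hx
  rw [upTrans_of_lt (by omega)]

theorem upLast_pos (hp : IsTransient p) (y : ℕ) {u : ℕ} (hu : 1 ≤ u) : 0 < upLast p y u := by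
  obtain ⟨u, rfl⟩ : ∃ s, u = s + 1 := ⟨u - 1, by omega⟩
  have h1 : 1 / D p y < 1 := (div_lt_one (hp.D_pos y)).2 (hp.one_lt_D y)
  exact mul_pos (pow_pos (by linarith) _) (one_div_pos.2 (hp.D_pos y))

theorem tendsto_inv_D (hp : IsTransient p) (hrho : Tendsto (rho p) atTop (𝓝 1)) :
    Tendsto (fun y => 1 / D p y) atTop (𝓝 0) := by
  simp only [one_div]
  exact (hp.tendsto_D_atTop hrho).inv_tendsto_atTop

theorem tendsto_upLast (hp : IsTransient p) (hrho : Tendsto (rho p) atTop (𝓝 1)) {u : ℕ}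
    (hu : 1 ≤ u) : Tendsto (fun y => upLast p y u * D p y) atTop (𝓝 1) := by
  obtain ⟨u, rfl⟩ : ∃ s, u = s + 1 := ⟨u - 1, by omega⟩
  have h := ((hp.tendsto_inv_D hrho).const_sub 1).pow u
  rw [sub_zero, one_pow] at h
  refine h.congr fun y => ?_
  have := (hp.D_pos y).ne'
  rw [upLast, mul_assoc, one_div_mul_cancel this, mul_one]

theorem tendsto_weakLast (hp : IsTransient p) (hrho : Tendsto (rho p) atTop (𝓝 1)) :
    Tendsto (fun y => weakLast p y * D p y) atTop (𝓝 2) := by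
  have h := (hrho.const_add 1).div ((hp.tendsto_inv_D hrho).add hrho) (by norm_num)
  rw [show ((1 : ℝ) + 1) / (0 + 1) = 2 by norm_num] at h
  refine h.congr fun y => ?_
  have := (hp.D_pos y).ne'
  have h2 := (hp.one_add_D_pos y).ne'
  have h3 : 1 / D p y + rho p y ≠ 0 := by
    have := one_div_pos.2 (hp.D_pos y)
    linarith [hp.rho_nonneg y]
  simp only [Pi.div_apply, weakLast]
  rw [div_mul_eq_mul_div, div_eq_div_iff h3 h2]
  field_simp

theorem tendsto_weakTrans (hp : IsTransient p) (hrho : Tendsto (rho p) atTop (𝓝 1)) :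
    Tendsto (fun q : ℕ × ℕ => weakTrans p q.1 (q.1 + q.2) * Dfin p q.1 (q.1 + q.2)) atTop
      (𝓝 2) := by
  have hr := hrho.comp tendsto_fst_atTop
  have h := ((hr.const_add 1).mul ((hp.tendsto_alphaDown hrho).const_sub 1)).div
    ((hp.tendsto_betaUp hrho).add hr) (by norm_num)
  rw [show ((1 : ℝ) + 1) * (1 - 0) / (0 + 1) = 2 by norm_num] at h
  refine h.congr fun q => ?_
  have hD := hp.Dfin_pos (show q.1 < q.1 + q.2 + 1 by omega)
  have h2 := (hp.one_add_pos q.1 (q.1 + q.2 + 1)).ne'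
  have h3 : 1 / Dfin p q.1 (q.1 + q.2 + 1) + rho p q.1 ≠ 0 := by
    have := one_div_pos.2 hD
    linarith [hp.rho_nonneg q.1]
  simp only [Pi.div_apply, weakTrans, alphaDown, betaUp, Function.comp, sub_sub_cancel]
  rw [div_mul_eq_mul_div, div_eq_div_iff h3 h2]
  field_simp

theorem exists_weakTrans_le (hp : IsTransient p) (hrho : Tendsto (rho p) atTop (𝓝 1)) :
    ∃ c > 0, ∀ x y, x < y → weakTrans p x y * Dfin p x y ≤ c := by
  obtain ⟨m, hm, hm'⟩ := hp.exists_le_rho hrho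
  -- At x = 0 the weight is 1 because ρ 0 = 0, and D(0, y) ≤ D(0) compensates. Otherwise the product
  -- is at most (1 + ρ x) / ρ x.
  refine ⟨max (D p 0) ((1 + m) / m), lt_max_of_lt_left (hp.D_pos 0), fun x y h => ?_⟩
  rcases Nat.eq_zero_or_pos x with rfl | hx
  · refine le_max_of_le_left ?_
    rw [weakTrans, hp.rho_zero]
    simpa using hp.Dfin_le_D 0 y
  · refine le_max_of_le_right ?_
    have h1 := hm' x hx
    have h2 := hp.Dfin_mono x (Nat.le_succ y)
    have h3 := hp.Dfin_nonneg x y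
    have h4 := hp.rho_nonneg x
    rw [weakTrans, div_mul_eq_mul_div, div_le_div_iff₀ (hp.one_add_pos _ _) hm]
    calc (1 + rho p x) * Dfin p x y * m = (m + m * rho p x) * Dfin p x y := by ring
      _ ≤ (rho p x + m * rho p x) * Dfin p x y := by gcongr
      _ ≤ (rho p x + m * rho p x) * Dfin p x (y + 1) := by gcongr
      _ ≤ (1 + m) * (1 + rho p x * Dfin p x (y + 1)) := by linarith

theorem exists_le_weakTrans (hp : IsTransient p) (hrho : Tendsto (rho p) atTop (𝓝 1)) :
    ∃ c > 0, ∀ x y, x < y → c ≤ weakTrans p x y * Dfin p x y := by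
  obtain ⟨M, hM, hM'⟩ := hp.exists_rho_le hrho
  refine ⟨1 / (1 + M), by positivity, fun x y h => ?_⟩
  have h1 := hp.Dfin_succ_le hM' h
  have h2 := hp.one_le_Dfin h
  have h3 := mul_le_mul_of_nonneg_left h1 (hp.rho_nonneg x)
  rw [weakTrans, div_mul_eq_mul_div, div_le_div_iff₀ (by linarith) (hp.one_add_pos _ _)]
  nlinarith

end IsTransient

/-! ### Estimates of the weights for the three classes -/

namespace CutClass

variable {C : CutClass}

theorem preTarget_of_pos {a b x : ℕ} (hx : 1 ≤ x) : preTarget a b x = a - b + 1 :=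
  if_neg (by omega)

theorem lam_pos (hC : C.Valid) : 0 < C.lam := by
  cases C with
  | weak => exact two_pos
  | both a b =>
    have : 0 < (a - 1).choose (b - 1) := Nat.choose_pos (Nat.sub_le_sub_right hC.2 1)
    rw [lam]
    positivity
  | up a => exact one_pos

theorem pairWeight_nonneg (hp : IsTransient p) (C : CutClass) {x y : ℕ} (h : x < y) :
    0 ≤ C.pairWeight p x y := by
  cases C with
  | weak => exact (hp.weakTrans_pos x y).le
  | both a b =>
    exact mul_nonneg (hp.upTrans_nonneg (Nat.sub_le x 1) _ _)
      (hp.upTrans_nonneg (by omega) _ _)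
  | up a => exact hp.upTrans_nonneg h.le _ _

theorem lastWeight_nonneg (hp : IsTransient p) (C : CutClass) (y : ℕ) :
    0 ≤ C.lastWeight p y := by
  cases C with
  | weak => exact (hp.weakLast_pos y).le
  | both a b =>
    exact mul_nonneg (hp.upTrans_nonneg (Nat.sub_le y 1) _ _) (hp.upLast_nonneg _ _)
  | up a => exact hp.upLast_nonneg _ _

/-- The two prescriptions of `C(a, b)` at a positive site are jointly realized with probability
bounded below. -/
theorem exists_le_upTrans_pred (hp : IsTransient p) (hrho : Tendsto (rho p) atTop (𝓝 1)) {t : ℕ}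
    (ht : 1 ≤ t) (u : ℕ) : ∃ c > 0, ∀ x, 1 ≤ x → c ≤ upTrans p (x - 1) t x u := by
  obtain ⟨c, hc, h⟩ := hp.exists_le_upTrans hrho ht u
  obtain ⟨M, hM, hM'⟩ := hp.exists_rho_le hrho
  refine ⟨c / (1 + M), by positivity, fun x hx => ?_⟩
  have h1 := h (x - 1) x (by omega)
  have h2 := hp.Dfin_succ_le hM' (show x - 1 < x by omega)
  have h3 : Dfin p (x - 1) x = 1 := by
    obtain ⟨x, rfl⟩ : ∃ z, x = z + 1 := ⟨x - 1, by omega⟩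
    simp
  rw [h3, mul_one] at h2
  rw [div_le_iff₀ (by linarith)]
  exact h1.trans (mul_le_mul_of_nonneg_left h2 (hp.upTrans_nonneg (by omega) _ _))

theorem lastWeight_pos (hp : IsTransient p) (hrho : Tendsto (rho p) atTop (𝓝 1)) (hC : C.Valid)
    {y : ℕ} (hy : 1 ≤ y) : 0 < C.lastWeight p y := by
  cases C with
  | weak => exact hp.weakLast_pos y
  | both a b =>
    obtain ⟨c, hc, h⟩ := exists_le_upTrans_pred hp hrho (Nat.le_add_left 1 (a - b)) b
    rw [lastWeight, preTarget_of_pos hy]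
    exact mul_pos (hc.trans_le (h y hy)) (hp.upLast_pos _ hC.1)
  | up a => exact hp.upLast_pos _ hC

/-- The levels x - 1 and x are adjacent, so both ruin probabilities tend to 1/2 and this transition
does not decay; it carries the whole constant λ. -/
theorem tendsto_pred_lam (hrho : Tendsto (rho p) atTop (𝓝 1)) {a b : ℕ}
    (hC : (both a b).Valid) :
    Tendsto (fun x => upTrans p (x - 1) (preTarget a b x) x b) atTop (𝓝 (both a b).lam) := by
  obtain ⟨hb, hab⟩ := hC
  have h := tendsto_upTrans_pred (b := b) hrho (Nat.le_add_left 1 (a - b))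
  have e1 : b - 1 + (a - b + 1 - 1) = a - 1 := by omega
  have e2 : a - b + 1 - 1 = a - 1 - (b - 1) := by omega
  rw [e1, e2, Nat.choose_symm (by omega), show a - 1 + 1 = a by omega] at h
  refine h.congr' ?_
  filter_upwards [eventually_ge_atTop 1] with x hx
  rw [preTarget_of_pos hx]

theorem tendsto_lastWeight (hp : IsTransient p) (hrho : Tendsto (rho p) atTop (𝓝 1))
    (hC : C.Valid) : Tendsto (fun y => C.lastWeight p y * D p y) atTop (𝓝 C.lam) := by
  cases C with
  | weak => exact hp.tendsto_weakLast hrho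
  | both a b =>
    have h := (tendsto_pred_lam hrho hC).mul (hp.tendsto_upLast hrho hC.1)
    rw [mul_one] at h
    exact h.congr fun y => (mul_assoc _ _ _).symm
  | up a => exact hp.tendsto_upLast hrho hC

theorem tendsto_pairWeight (hp : IsTransient p) (hrho : Tendsto (rho p) atTop (𝓝 1))
    (hC : C.Valid) : Tendsto (fun q : ℕ × ℕ => C.pairWeight p q.1 (q.1 + q.2) *
      Dfin p q.1 (q.1 + q.2)) atTop (𝓝 C.lam) := by
  cases C with
  | weak => exact hp.tendsto_weakTrans hrho
  | both a b =>
    have hshift : Tendsto (fun q : ℕ × ℕ => (q.1, q.2 - 1)) atTop atTop := by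
      rw [← prod_atTop_atTop_eq]
      exact tendsto_fst.prodMk ((tendsto_sub_atTop_nat 1).comp tendsto_snd)
    have h := ((tendsto_pred_lam hrho hC).comp tendsto_fst_atTop).mul
      ((hp.tendsto_upTrans hrho hC.1 (a - b + 1)).comp hshift)
    rw [mul_one] at h
    refine h.congr' ?_
    filter_upwards [tendsto_snd_atTop.eventually_ge_atTop 1] with q hq
    simp only [Function.comp, pairWeight]
    rw [preTarget_of_pos (show 1 ≤ q.1 + q.2 by omega), Nat.add_sub_assoc hq, mul_assoc,
      show q.1 + (q.2 - 1) + 1 = q.1 + q.2 by omega]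
  | up a =>
    -- The factor `1 - alphaDown` is D(x, y) / D(x, y + 1), which turns the natural normalization
    -- into the required one.
    have h := (hp.tendsto_upTrans hrho hC a).mul ((hp.tendsto_alphaDown hrho).const_sub 1)
    rw [sub_zero, mul_one] at h
    refine h.congr fun q => ?_
    have hD := (hp.Dfin_pos (show q.1 < q.1 + q.2 + 1 by omega)).ne'
    rw [alphaDown, sub_sub_cancel, mul_assoc, mul_div_cancel₀ _ hD, pairWeight]

theorem exists_pairWeight_le (hp : IsTransient p) (hrho : Tendsto (rho p) atTop (𝓝 1))
    (C : CutClass) : ∃ c > 0, ∀ x y, x < y → C.pairWeight p x y * Dfin p x y ≤ c := by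
  cases C with
  | weak => exact hp.exists_weakTrans_le hrho
  | both a b =>
    refine ⟨b + 1, by positivity, fun x y h => ?_⟩
    have h1 := hp.upTrans_mul_Dfin_le (show x ≤ y - 1 by omega) b (preTarget a b y)
    rw [Nat.sub_add_cancel (by omega)] at h1
    have h2 := hp.upTrans_le_one (Nat.sub_le x 1) (preTarget a b x) b
    rw [pairWeight, mul_assoc]
    refine (mul_le_of_le_one_left ?_ h2).trans h1
    exact mul_nonneg (hp.upTrans_nonneg (by omega) _ _) (hp.Dfin_nonneg _ _)
  | up a =>
    refine ⟨a + 1, by positivity, fun x y h => ?_⟩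
    exact (mul_le_mul_of_nonneg_left (hp.Dfin_mono x (Nat.le_succ y))
      (hp.upTrans_nonneg h.le _ _)).trans (hp.upTrans_mul_Dfin_le h.le a a)

theorem exists_le_pairWeight (hp : IsTransient p) (hrho : Tendsto (rho p) atTop (𝓝 1))
    (hC : C.Valid) :
    ∃ c > 0, ∀ x y, x < y → C.Compatible x y → c ≤ C.pairWeight p x y * Dfin p x y := by
  cases C with
  | weak =>
    obtain ⟨c, hc, h⟩ := hp.exists_le_weakTrans hrho
    exact ⟨c, hc, fun x y hxy _ => h x y hxy⟩
  | both a b =>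
    obtain ⟨hb, hab⟩ := hC
    obtain ⟨c₁, hc₁, h₁⟩ := exists_le_upTrans_pred hp hrho (Nat.le_add_left 1 (a - b)) b
    obtain ⟨c₂, hc₂, h₂⟩ := hp.exists_le_upTrans hrho hb (a - b + 1)
    refine ⟨min c₁ 1 * min c₂ 1, by positivity, fun x y hxy hcomp => ?_⟩
    have e1 : min c₁ 1 ≤ upTrans p (x - 1) (preTarget a b x) x b := by
      rcases Nat.eq_zero_or_pos x with rfl | hx
      · have : a = b := hcomp.1.resolve_left (by omega)
        refine (min_le_right _ _).trans (le_of_eq ?_)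
        simp [upTrans, preTarget, this]
      · rw [preTarget_of_pos hx]
        exact (min_le_left _ _).trans (h₁ x hx)
    have e2 : min c₂ 1 ≤ upTrans p x b (y - 1) (preTarget a b y) * Dfin p x y := by
      rw [preTarget_of_pos (by omega)]
      rcases Nat.lt_or_ge y (x + 2) with hy | hy
      -- Both prescriptions are at x here, and compatibility makes them equal.
      · obtain rfl : y = x + 1 := by omega
        have : b = a - b + 1 := by
          have := hcomp.2.resolve_left (by omega)
          omega
        refine (min_le_right _ _).trans (le_of_eq ?_)
        rw [Nat.add_sub_cancel, Dfin_self_succ, upTrans, if_pos rfl, if_pos this, mul_one]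
      · have := h₂ x (y - 1) (by omega)
        rw [Nat.sub_add_cancel (by omega)] at this
        exact (min_le_left _ _).trans this
    rw [pairWeight, mul_assoc]
    exact mul_le_mul e1 e2 (by positivity) (hp.upTrans_nonneg (Nat.sub_le x 1) _ _)
  | up a =>
    obtain ⟨c, hc, h⟩ := hp.exists_le_upTrans hrho hC a
    obtain ⟨M, hM, hM'⟩ := hp.exists_rho_le hrho
    refine ⟨c / (1 + M), by positivity, fun x y hxy _ => ?_⟩
    rw [div_le_iff₀ (by linarith)]
    refine (h x y hxy).trans ?_
    rw [pairWeight, mul_assoc, mul_comm (Dfin p x y)]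
    exact mul_le_mul_of_nonneg_left (hp.Dfin_succ_le hM' hxy) (hp.upTrans_nonneg hxy.le _ _)

/-! ### From weights to probabilities -/

section Probability

variable {Ω : Type*} [MeasurableSpace Ω] {P : Measure Ω} [IsProbabilityMeasure P]
  {X : ℕ → Ω → ℕ}

theorem real_event (hp : IsTransient p) (hX : IsWalk P p X) (hC : C.Valid) (x : ℕ) :
    NullMeasurableSet (C.event X x) P ∧ P.real (C.event X x) = C.lastWeight p x := by
  have h := real_forall_event hp hX hC le_rfl (j := fun _ => x) (by simp)
  have e : {ω | ∀ i ∈ Finset.Icc 1 1, ω ∈ C.event X ((fun _ => x) i)} = C.event X x := by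
    ext ω; simp
  rw [e] at h
  simpa using h

theorem real_event_inter (hp : IsTransient p) (hX : IsWalk P p X) (hC : C.Valid) {x y : ℕ}
    (hxy : x < y) : P.real (C.event X x ∩ C.event X y) =
      C.pairWeight p x y * C.lastWeight p y := by
  have h := (real_forall_event hp hX hC (k := 2) (by norm_num)
    (j := fun i => if i = 1 then x else y) (by simpa using hxy)).2
  have e : {ω | ∀ i ∈ Finset.Icc 1 2, ω ∈ C.event X ((fun i => if i = 1 then x else y) i)} =
      C.event X x ∩ C.event X y := by
    ext ω
    simp only [Set.mem_ofPred_eq, Finset.mem_Icc, Set.mem_inter_iff]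
    refine ⟨fun hw => ⟨by simpa using hw 1 (by norm_num), by simpa using hw 2 (by norm_num)⟩,
      fun hw i hi => ?_⟩
    by_cases h1 : i = 1
    · rw [if_pos h1]; exact hw.1
    · rw [if_neg h1]; exact hw.2
  rw [e] at h
  simpa using h

theorem real_cond_event (hp : IsTransient p) (hX : IsWalk P p X) (hC : C.Valid) (x y : ℕ) :
    (ProbabilityTheory.cond P (C.event X x)).real (C.event X y) =
      (P.real (C.event X x))⁻¹ * P.real (C.event X y ∩ C.event X x) := by
  rw [ProbabilityTheory.cond, measureReal_def, Measure.smul_apply, smul_eq_mul,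
    Measure.restrict_apply₀' (real_event hp hX hC x).1, ENNReal.toReal_mul, ENNReal.toReal_inv]
  rfl

theorem real_cond_lower (hp : IsTransient p) (hX : IsWalk P p X) (hC : C.Valid) {x y : ℕ}
    (hxy : x < y) : (ProbabilityTheory.cond P (C.event X x)).real (C.event X y) =
      (C.lastWeight p x)⁻¹ * (C.pairWeight p x y * C.lastWeight p y) := by
  rw [real_cond_event hp hX hC, Set.inter_comm, real_event_inter hp hX hC hxy,
    (real_event hp hX hC x).2]

theorem real_cond_upper (hp : IsTransient p) (hrho : Tendsto (rho p) atTop (𝓝 1))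
    (hX : IsWalk P p X) (hC : C.Valid) {x y : ℕ} (hxy : x < y) :
    (ProbabilityTheory.cond P (C.event X y)).real (C.event X x) = C.pairWeight p x y := by
  rw [real_cond_event hp hX hC, real_event_inter hp hX hC hxy, (real_event hp hX hC y).2,
    mul_comm (C.pairWeight p x y),
    inv_mul_cancel_left₀ (lastWeight_pos hp hrho hC (by omega)).ne']

end Probability

/-- The factor by which `P(y ∈ C | x ∈ C)` differs from `D x / (Dfin x y * D y)`. -/
theorem cond_lower_eq (hp : IsTransient p) (C : CutClass) {x y : ℕ} (hxy : x < y) :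
    (C.lastWeight p x)⁻¹ * (C.pairWeight p x y * C.lastWeight p y) =
      (C.pairWeight p x y * Dfin p x y) * (C.lastWeight p y * D p y) /
        (C.lastWeight p x * D p x) * (D p x / (Dfin p x y * D p y)) := by
  have h1 := (hp.Dfin_pos hxy).ne'
  have h2 := (hp.D_pos x).ne'
  have h3 := (hp.D_pos y).ne'
  rcases eq_or_ne (C.lastWeight p x) 0 with h0 | h0
  · simp [h0]
  · field_simp

theorem exists_lastWeight_le (hp : IsTransient p) (hrho : Tendsto (rho p) atTop (𝓝 1))
    (hC : C.Valid) : ∃ c > 0, ∀ y, C.lastWeight p y * D p y ≤ c := by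
  obtain ⟨c, hc⟩ := (tendsto_lastWeight hp hrho hC).bddAbove_range
  exact ⟨max c 1, by positivity, fun y => (hc ⟨y, rfl⟩).trans (le_max_left _ _)⟩

theorem exists_cond_lower_le (hp : IsTransient p) (hrho : Tendsto (rho p) atTop (𝓝 1))
    (hC : C.Valid) : ∃ c > 0, ∀ x y, x < y →
      (C.lastWeight p x)⁻¹ * (C.pairWeight p x y * C.lastWeight p y) ≤
        c * D p x / (Dfin p x y * D p y) := by
  obtain ⟨c₁, hc₁, h₁⟩ := exists_pairWeight_le hp hrho C
  obtain ⟨c₂, hc₂, h₂⟩ := exists_lastWeight_le hp hrho hC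
  -- `lastWeight` may vanish at 0 for C(a, b), so the lower bound is an alternative. In the null
  -- case the left side is 0, inverses of 0 being 0.
  obtain ⟨c₃, hc₃, h₃⟩ := exists_pos_le_of_eventually
    (fun x => mul_nonneg (lastWeight_nonneg hp C x) (hp.D_pos x).le) (half_pos (lam_pos hC))
    ((tendsto_lastWeight hp hrho hC).eventually_const_le (half_lt_self (lam_pos hC)))
  refine ⟨c₁ * c₂ / c₃, by positivity, fun x y hxy => ?_⟩
  have hq : 0 < D p x / (Dfin p x y * D p y) :=
    div_pos (hp.D_pos x) (mul_pos (hp.Dfin_pos hxy) (hp.D_pos y))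
  rw [cond_lower_eq hp C hxy, mul_div_assoc (c₁ * c₂ / c₃)]
  refine mul_le_mul_of_nonneg_right ?_ hq.le
  rcases h₃ x with h0 | h0
  · rw [h0, div_zero]
    positivity
  · have h4 : 0 ≤ C.lastWeight p y * D p y :=
      mul_nonneg (lastWeight_nonneg hp C y) (hp.D_pos y).le
    exact div_le_div₀ (by positivity) (mul_le_mul (h₁ x y hxy) (h₂ y) h4 hc₁.le) hc₃ h0

theorem prod_div_mul_div {j : ℕ → ℕ} {c : ℝ} {k : ℕ} (hk : 1 ≤ k) :
    (∏ i ∈ Finset.Ico 1 k, c / Dfin p (j i) (j (i + 1))) * (c / D p (j k)) =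
      c ^ k / (D p (j k) * ∏ i ∈ Finset.Ico 1 k, Dfin p (j i) (j (i + 1))) := by
  rw [Finset.prod_div_distrib, Finset.prod_const, Nat.card_Ico, div_mul_div_comm, ← pow_succ,
    Nat.sub_add_cancel hk, mul_comm (∏ i ∈ _, _)]

theorem exists_joint_le (hp : IsTransient p) (hrho : Tendsto (rho p) atTop (𝓝 1))
    (hC : C.Valid) {k : ℕ} (hk : 1 ≤ k) : ∃ c > 0, ∀ j : ℕ → ℕ,
      (∀ i ∈ Finset.Ico 1 k, j i < j (i + 1)) →
      (∏ i ∈ Finset.Ico 1 k, C.pairWeight p (j i) (j (i + 1))) * C.lastWeight p (j k) ≤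
        c / ((∏ i ∈ Finset.Ico 1 k, Dfin p (j i) (j (i + 1))) * D p (j k)) := by
  obtain ⟨c₁, hc₁, h₁⟩ := exists_pairWeight_le hp hrho C
  obtain ⟨c₂, hc₂, h₂⟩ := exists_lastWeight_le hp hrho hC
  refine ⟨max c₁ c₂ ^ k, by positivity, fun j hj => ?_⟩
  rw [mul_comm (∏ i ∈ _, Dfin p _ _), ← prod_div_mul_div hk]
  refine mul_le_mul (Finset.prod_le_prod (fun i hi => pairWeight_nonneg hp C (hj i hi))
    fun i hi => ?_) ?_ (lastWeight_nonneg hp C _) (Finset.prod_nonneg fun i hi => ?_)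
  · rw [le_div_iff₀ (hp.Dfin_pos (hj i hi))]
    exact (h₁ _ _ (hj i hi)).trans (le_max_left _ _)
  · rw [le_div_iff₀ (hp.D_pos _)]
    exact (h₂ _).trans (le_max_right _ _)
  · exact div_nonneg (by positivity) (hp.Dfin_nonneg _ _)

theorem exists_uniform (hp : IsTransient p) (hrho : Tendsto (rho p) atTop (𝓝 1))
    (hC : C.Valid) {ε : ℝ} (hε : 0 < ε) : ∃ N : ℕ, 0 < N ∧
      (∀ x, N < x → C.lam - ε ≤ C.lastWeight p x * D p x ∧
        C.lastWeight p x * D p x ≤ C.lam + ε) ∧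
      ∀ x y, N < x → x + N < y →
        (C.lam - ε ≤ C.pairWeight p x y * Dfin p x y ∧
          C.pairWeight p x y * Dfin p x y ≤ C.lam + ε) ∧
        (1 - ε ≤ C.pairWeight p x y * Dfin p x y / (C.lastWeight p x * D p x) ∧
          C.pairWeight p x y * Dfin p x y / (C.lastWeight p x * D p x) ≤ 1 + ε) ∧
        C.lam - ε ≤ C.pairWeight p x y * Dfin p x y * (C.lastWeight p y * D p y) /
          (C.lastWeight p x * D p x) ∧
        C.pairWeight p x y * Dfin p x y * (C.lastWeight p y * D p y) /
          (C.lastWeight p x * D p x) ≤ C.lam + ε := by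
  have hlam := (lam_pos hC).ne'
  have hE := tendsto_lastWeight hp hrho hC
  have hB := tendsto_pairWeight hp hrho hC
  have hE1 := hE.comp tendsto_fst_atTop
  have hE2 := hE.comp (tendsto_fst_atTop.atTop_add_atTop tendsto_snd_atTop)
  have hR := hB.div hE1 hlam
  have hS := (hB.mul hE2).div hE1 hlam
  rw [div_self hlam] at hR
  rw [mul_div_cancel_right₀ _ hlam] at hS
  have between : ∀ {ι : Type} {l : Filter ι} {f : ι → ℝ} {c : ℝ}, Tendsto f l (𝓝 c) →
      ∀ᶠ i in l, c - ε ≤ f i ∧ f i ≤ c + ε := fun h =>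
    (h.eventually_const_le (by linarith)).and (h.eventually_le_const (by linarith))
  obtain ⟨N₁, h₁⟩ := eventually_atTop.1 (between hE)
  obtain ⟨N₂, h₂⟩ := exists_forall_of_eventually
    (Q := fun x y => (C.lam - ε ≤ C.pairWeight p x y * Dfin p x y ∧
          C.pairWeight p x y * Dfin p x y ≤ C.lam + ε) ∧
        (1 - ε ≤ C.pairWeight p x y * Dfin p x y / (C.lastWeight p x * D p x) ∧
          C.pairWeight p x y * Dfin p x y / (C.lastWeight p x * D p x) ≤ 1 + ε) ∧
        C.lam - ε ≤ C.pairWeight p x y * Dfin p x y * (C.lastWeight p y * D p y) /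
          (C.lastWeight p x * D p x) ∧
        C.pairWeight p x y * Dfin p x y * (C.lastWeight p y * D p y) /
          (C.lastWeight p x * D p x) ≤ C.lam + ε)
    ((between hB).and ((between hR).and (between hS)))
  exact ⟨max N₁ N₂ + 1, by omega, fun x hx => h₁ x (by omega),
    fun x y hx hy => h₂ x y (by omega) (by omega)⟩

end CutClass

end

end CutWalk

/-! ### The five statements -/

theorem proposition4 {Ω : Type*} [MeasurableSpace Ω] (P : Measure Ω) [IsProbabilityMeasure P]
    (p : ℕ → ℝ) (hp0 : p 0 = 1) (hp : ∀ k, 1 ≤ k → 0 < p k ∧ p k < 1)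
    (X : ℕ → Ω → ℕ) (hX : CutWalk.IsWalk P p X)
    (hfin : Summable fun k : ℕ => ∏ i ∈ Finset.Icc 1 k, CutWalk.rho p i)
    (hrho : Tendsto (CutWalk.rho p) atTop (𝓝 1))
    (C : CutWalk.CutClass) (hC : C.Valid) :
    Tendsto (fun x => P.real (C.event X x) * CutWalk.D p x) atTop (𝓝 C.lam) ∧
    (∃ c : ℝ, 0 < c ∧ ∀ x y : ℕ, x < y →
      (ProbabilityTheory.cond P (C.event X x)).real (C.event X y) ≤
        c * CutWalk.D p x / (CutWalk.Dfin p x y * CutWalk.D p y)) ∧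
    (∃ c : ℝ, 0 < c ∧ ∀ x y : ℕ, x < y → C.Compatible x y →
      c / CutWalk.Dfin p x y ≤
        (ProbabilityTheory.cond P (C.event X y)).real (C.event X x)) ∧
    (∀ k : ℕ, 1 ≤ k → ∃ c : ℝ, 0 < c ∧ ∀ j : ℕ → ℕ, 0 < j 1 →
      (∀ i ∈ Finset.Ico 1 k, j i < j (i + 1)) →
      P.real {ω | ∀ i ∈ Finset.Icc 1 k, ω ∈ C.event X (j i)} ≤
        c / ((∏ i ∈ Finset.Ico 1 k, CutWalk.Dfin p (j i) (j (i + 1))) * CutWalk.D p (j k))) ∧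
    (∀ ε : ℝ, 0 < ε → ε < C.lam → ∃ N : ℕ, 0 < N ∧
      (∀ x y : ℕ, N < x → x + N < y →
        (1 - ε ≤ CutWalk.Dfin p x y / CutWalk.D p x *
            (P.real (C.event X x ∩ C.event X y) /
              (P.real (C.event X x) * P.real (C.event X y))) ∧
          CutWalk.Dfin p x y / CutWalk.D p x *
            (P.real (C.event X x ∩ C.event X y) /
              (P.real (C.event X x) * P.real (C.event X y))) ≤ 1 + ε) ∧
        ((C.lam - ε) * (CutWalk.D p x / (CutWalk.Dfin p x y * CutWalk.D p y)) ≤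
            (ProbabilityTheory.cond P (C.event X x)).real (C.event X y) ∧
          (ProbabilityTheory.cond P (C.event X x)).real (C.event X y) ≤
            (C.lam + ε) * (CutWalk.D p x / (CutWalk.Dfin p x y * CutWalk.D p y)))) ∧
      (∀ (k : ℕ) (j : ℕ → ℕ), 1 ≤ k → j 0 = 0 →
        (∀ i ∈ Finset.Icc 1 k, j (i - 1) + N < j i) →
        (C.lam - ε) ^ k /
            (CutWalk.D p (j k) * ∏ i ∈ Finset.Ico 1 k, CutWalk.Dfin p (j i) (j (i + 1))) ≤
          P.real {ω | ∀ i ∈ Finset.Icc 1 k, ω ∈ C.event X (j i)} ∧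
        P.real {ω | ∀ i ∈ Finset.Icc 1 k, ω ∈ C.event X (j i)} ≤
          (C.lam + ε) ^ k /
            (CutWalk.D p (j k) * ∏ i ∈ Finset.Ico 1 k, CutWalk.Dfin p (j i) (j (i + 1))))) := by
  have htr : CutWalk.IsTransient p := ⟨hp0, hp, hfin⟩
  have hE : ∀ x, P.real (C.event X x) = C.lastWeight p x := fun x =>
    (CutWalk.CutClass.real_event htr hX hC x).2
  refine ⟨?_, ?_, ?_, ?_, ?_⟩
  · simp only [hE]
    exact CutWalk.CutClass.tendsto_lastWeight htr hrho hC
  · obtain ⟨c, hc, h⟩ := CutWalk.CutClass.exists_cond_lower_le htr hrho hC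
    refine ⟨c, hc, fun x y hxy => ?_⟩
    rw [CutWalk.CutClass.real_cond_lower htr hX hC hxy]
    exact h x y hxy
  · obtain ⟨c, hc, h⟩ := CutWalk.CutClass.exists_le_pairWeight htr hrho hC
    refine ⟨c, hc, fun x y hxy hcomp => ?_⟩
    rw [CutWalk.CutClass.real_cond_upper htr hrho hX hC hxy, div_le_iff₀ (htr.Dfin_pos hxy)]
    exact h x y hxy hcomp
  · intro k hk
    obtain ⟨c, hc, h⟩ := CutWalk.CutClass.exists_joint_le htr hrho hC hk
    refine ⟨c, hc, fun j _ hj => ?_⟩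
    rw [(CutWalk.CutClass.real_forall_event htr hX hC hk hj).2]
    exact h j hj
  · intro ε hε hlam
    obtain ⟨N, hN, hlast, hpair⟩ := CutWalk.CutClass.exists_uniform htr hrho hC hε
    refine ⟨N, hN, fun x y hx hy => ?_, fun k j hk hj0 hj => ?_⟩
    · obtain ⟨-, h1, h2⟩ := hpair x y hx hy
      have hxy : x < y := by omega
      have hq : 0 ≤ CutWalk.D p x / (CutWalk.Dfin p x y * CutWalk.D p y) :=
        (div_pos (htr.D_pos x) (mul_pos (htr.Dfin_pos hxy) (htr.D_pos y))).le
      have hEx := (CutWalk.CutClass.lastWeight_pos htr hrho hC (show 1 ≤ x by omega)).ne'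
      have hEy := (CutWalk.CutClass.lastWeight_pos htr hrho hC (show 1 ≤ y by omega)).ne'
      have hDx := (htr.D_pos x).ne'
      have hr : CutWalk.Dfin p x y / CutWalk.D p x *
          (P.real (C.event X x ∩ C.event X y) /
            (P.real (C.event X x) * P.real (C.event X y))) =
          C.pairWeight p x y * CutWalk.Dfin p x y / (C.lastWeight p x * CutWalk.D p x) := by
        rw [CutWalk.CutClass.real_event_inter htr hX hC hxy, hE, hE]
        field_simp
      rw [hr, CutWalk.CutClass.real_cond_lower htr hX hC hxy,
        CutWalk.CutClass.cond_lower_eq htr C hxy]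
      exact ⟨h1, mul_le_mul_of_nonneg_right h2.1 hq, mul_le_mul_of_nonneg_right h2.2 hq⟩
    -- The gap between `j 0 = 0` and `j 1` puts every site beyond N, so one N serves all k and all
    -- factors.
    · have hjN : ∀ i, 1 ≤ i → i ≤ k → N < j i := by
        intro i h1 hik
        induction i, h1 using Nat.le_induction with
        | base =>
          have := hj 1 (Finset.mem_Icc.2 ⟨le_rfl, hik⟩)
          rw [Nat.sub_self, hj0] at this
          omega
        | succ i hi ih =>
          have := hj (i + 1) (Finset.mem_Icc.2 ⟨by omega, hik⟩)
          rw [Nat.add_sub_cancel] at this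
          omega
      have hgap : ∀ i ∈ Finset.Ico 1 k, N < j i ∧ j i + N < j (i + 1) := by
        intro i hi
        obtain ⟨h1, h2⟩ := Finset.mem_Ico.1 hi
        have := hj (i + 1) (Finset.mem_Icc.2 ⟨by omega, h2⟩)
        rw [Nat.add_sub_cancel] at this
        exact ⟨hjN i h1 h2.le, this⟩
      have hlt : ∀ i ∈ Finset.Ico 1 k, j i < j (i + 1) := fun i hi => by
        have := (hgap i hi).2
        omega
      have hl := hlast (j k) (hjN k hk le_rfl)
      have hpos : 0 ≤ C.lam - ε := by linarith
      rw [(CutWalk.CutClass.real_forall_event htr hX hC hk hlt).2,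
        ← CutWalk.CutClass.prod_div_mul_div hk, ← CutWalk.CutClass.prod_div_mul_div hk]
      constructor
      · refine mul_le_mul (Finset.prod_le_prod (fun i _ => div_nonneg hpos (htr.Dfin_nonneg _ _))
          fun i hi => ?_) ?_ (div_nonneg hpos (htr.D_pos _).le)
          (Finset.prod_nonneg fun i hi => CutWalk.CutClass.pairWeight_nonneg htr C (hlt i hi))
        · rw [div_le_iff₀ (htr.Dfin_pos (hlt i hi))]
          exact (hpair _ _ (hgap i hi).1 (hgap i hi).2).1.1
        · rw [div_le_iff₀ (htr.D_pos _)]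
          exact hl.1
      · refine mul_le_mul (Finset.prod_le_prod (fun i hi =>
          CutWalk.CutClass.pairWeight_nonneg htr C (hlt i hi)) fun i hi => ?_) ?_
          (CutWalk.CutClass.lastWeight_nonneg htr C _)
          (Finset.prod_nonneg fun i _ => div_nonneg (by linarith) (htr.Dfin_nonneg _ _))
        · rw [le_div_iff₀ (htr.Dfin_pos (hlt i hi))]
          exact (hpair _ _ (hgap i hi).1 (hgap i hi).2).1.2
        · rw [le_div_iff₀ (htr.D_pos _)]
          exact hl.2
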